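/- Let $R$ be a commutative ring with unit, $n\ge 0$ an integer, $[n]=\{1,\dots,n\}$, and let $S=R[X_1,\dots,X_n]$ carry the $\mathbb{Z}^n$-grading with $\deg X_s=\varepsilon_s$, the $s$-th standard basis vector. For $F\subseteq[n]$ let $R[F]\subseteq S$ be the $R$-subalgebra generated by the $X_s$ with $s\in F$. For $a\in\mathbb{Z}^n$ put $|a|=a_1+\dots+a_n$. A $\mathbb{Z}^n$-graded $S$-module $M$ is called bounded below if there is $c\in\mathbb{Z}$ with $M_a=0$ for all $a$ with $|a|\le c$. A family of abelian groups $H_i(F)_a$ ($F\subseteq[n]$, $i\in\mathbb{N}=\{0,1,2,\dots\}$, $a\in\mathbb{Z}^n$) is called a polyseq if (i) $H_i(\emptyset)_a=0$ for all $i>0$ and all $a$; (ii) there is $c\in\mathbb{Z}$ such that $H_i(F)_a=0$ for all $F$, $i$ and all $a$ with $|a|\le c$; (iii) for all $F\subseteq[n]$, $i\in\mathbb{N}$, $a\in\mathbb{Z}^n$ and $s\in[n]\setminus F$ there are group homomorphisms $\iota_s=\iota(F,i,a,s)\colon H_i(F)_a\to H_i(F\cup\{s\})_a$, $\pi_s=\pi(F,i,a,s)\colon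 H_i(F\cup\{s\})_a\to H_{i-1}(F)_{a-\varepsilon_s}$ and $\partial_s=\partial(F,i,a,s)\colon H_i(F)_{a-\varepsilon_s}\to H_i(F)_a$ such that all the sequences $$H_i(F)_{a-\varepsilon_s}\xrightarrow{\partial_s}H_i(F)_a\xrightarrow{\iota_s}H_i(F\cup\{s\})_a\xrightarrow{\pi_s}H_{i-1}(F)_{a-\varepsilon_s}\xrightarrow{\partial_s}H_{i-1}(F)_a$$ are exact, where $H_{-1}(F)_a$ is read as $0$. **Proposition.** Let $M$ and $N$ be bounded below $\mathbb{Z}^n$-graded $S$-modules such that $M$ or $N$ is flat as an $R$-module. Then the family $$T_i(F)_a=\operatorname{Tor}_i^S(S\otimes_{R[F]}M,\,N)_a\qquad(F\subseteq[n],\ i\in\mathbb{N},\ a\in\mathbb{Z}^n)$$ is a polyseq. Here $S\otimes_{R[F]}M$ is a graded $S$-module with $S$ acting on the left factor and with $\deg(p\otimes m)=\deg p+\deg m$ for homogeneous $p$ and $m$, and $\operatorname{Tor}_i^S(-,N)_a$ is the component of degree $a$ of the $i$-th homology of the tensor product with a $\mathbb{Z}^n$-graded free resolution of $N$. -/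

import Mathlib

open scoped TensorProduct

universe u v w

namespace ZnGraded

/-- The total degree `|a| = a₁ + ⋯ + aₙ` of `a ∈ ℤⁿ`. -/
def totalDegree {n : ℕ} (a : Fin n → ℤ) : ℤ := ∑ j, a j

/-- The standard basis vector `ε_s` of `ℤⁿ`. -/
def eps {n : ℕ} (s : Fin n) : Fin n → ℤ := Pi.single s 1

/-- A family `H_i(F)_a` of abelian groups, indexed by `F ⊆ [n]`, `i ∈ ℕ`, `a ∈ ℤⁿ`, is a polyseq.
The homological degree `-1` that occurs in the fundamental exact sequence for `i = 0` is read as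
the zero group, so that this sequence ends with `H_0(F ∪ {s})_a → 0`. The families of maps are
only constrained at those `s` that do not lie in `F`. -/
structure IsPolyseq {n : ℕ} (H : Finset (Fin n) → ℕ → (Fin n → ℤ) → Type w)
    [∀ F i a, AddCommGroup (H F i a)] : Prop where
  /-- `H_i(∅) = 0` for `i > 0`. -/
  empty : ∀ i : ℕ, 0 < i → ∀ a, Subsingleton (H ∅ i a)
  /-- `H_i(F)_a = 0` for `|a| ≪ 0`. -/
  boundedBelow : ∃ c : ℤ, ∀ F i a, totalDegree a ≤ c → Subsingleton (H F i a)
  /-- The fundamental exact sequences. -/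
  exact : ∃ (iota : ∀ F i a s, H F i a →+ H (insert s F) i a)
    (pi : ∀ F i a s, H (insert s F) (i + 1) a →+ H F i (a - eps s))
    (del : ∀ F i a s, H F i (a - eps s) →+ H F i a),
    ∀ (F : Finset (Fin n)) (s : Fin n), s ∉ F → ∀ a : Fin n → ℤ,
      (∀ i, Function.Exact (del F i a s) (iota F i a s)) ∧
      Function.Surjective (iota F 0 a s) ∧
      (∀ i, Function.Exact (iota F (i + 1) a s) (pi F i a s)) ∧
      (∀ i, Function.Exact (pi F i a s) (del F i a s))

/-- The `ℤⁿ`-grading of `S = R[X₁, …, Xₙ]` with `deg X_s = ε_s`. -/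
noncomputable def polyGrading (R : Type u) [CommRing R] (n : ℕ) (a : Fin n → ℤ) :
    Submodule R (MvPolynomial (Fin n) R) :=
  MvPolynomial.weightedHomogeneousSubmodule R eps a

/-- A `ℤⁿ`-graded module is bounded below if `M_a = 0` for `|a| ≪ 0`. -/
def BoundedBelow {n : ℕ} {M : Type v} [AddCommGroup M] (𝓜 : (Fin n → ℤ) → AddSubgroup M) : Prop :=
  ∃ c : ℤ, ∀ a, totalDegree a ≤ c → 𝓜 a = ⊥

section Tensor

variable {T : Type u} [CommRing T] {n : ℕ} {A : Type v} {B : Type w} [AddCommGroup A]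
  [AddCommGroup B] [Module T A] [Module T B]

/-- The grading of a tensor product of graded modules: the component of degree `a` is generated by
the `x ⊗ y` with `x`, `y` homogeneous and `deg x + deg y = a`. -/
def tensorGrading (T : Type u) [CommRing T] [Module T A] [Module T B]
    (𝓐 : (Fin n → ℤ) → AddSubgroup A) (𝓑 : (Fin n → ℤ) → AddSubgroup B) (a : Fin n → ℤ) :
    AddSubgroup (A ⊗[T] B) :=
  AddSubgroup.closure {t | ∃ b c, b + c = a ∧ ∃ x ∈ 𝓐 b, ∃ y ∈ 𝓑 c, t = x ⊗ₜ[T] y}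

end Tensor

section Extend

variable (R : Type u) [CommRing R] {n : ℕ} {M : Type v} [AddCommGroup M]
  [Module (MvPolynomial (Fin n) R) M]

/-- The `S`-module `S ⊗_{R[F]} M`, where `R[F] ⊆ S` is the subalgebra generated by the `X_j`
with `j ∈ F`. -/
abbrev Extend (M : Type v) [AddCommGroup M] [Module (MvPolynomial (Fin n) R) M]
    (F : Finset (Fin n)) : Type (max u v) :=
  MvPolynomial (Fin n) R ⊗[MvPolynomial.supported R (F : Set (Fin n))] M

/-- The `ℤⁿ`-grading of `S ⊗_{R[F]} M`. -/
noncomputable def extendGrading (𝓜 : (Fin n → ℤ) → AddSubgroup M) (F : Finset (Fin n))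
    (a : Fin n → ℤ) : AddSubgroup (Extend R M F) :=
  tensorGrading (MvPolynomial.supported R (F : Set (Fin n)))
    (fun b => (polyGrading R n b).toAddSubgroup) 𝓜 a

end Extend

section Resolution

/-- The nonzero homogeneous elements (with their degrees) of a graded module. The parameter `R`
only serves to fix the universe. -/
structure HomGen (R : Type u) {n : ℕ} {N : Type w} [AddCommGroup N]
    (𝓝 : (Fin n → ℤ) → AddSubgroup N) : Type (max u w) where
  deg : Fin n → ℤ
  val : N
  mem : val ∈ 𝓝 deg
  ne_zero : val ≠ 0

/-- The grading of the free `S`-module `⨁ S(-deg g)` with basis elements `g` of degree `deg g`. -/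
noncomputable def freeGrading (R : Type u) [CommRing R] {n : ℕ} {ι : Type v}
    (deg : ι → Fin n → ℤ) (a : Fin n → ℤ) : AddSubgroup (ι →₀ MvPolynomial (Fin n) R) where
  carrier := {f | ∀ g, f g ∈ polyGrading R n (a - deg g)}
  zero_mem' _ := zero_mem _
  add_mem' hf hf' g := add_mem (hf g) (hf' g)
  neg_mem' hf g := neg_mem (hf g)

/-- A graded free `S`-module, given by a homogeneous basis, together with a submodule. -/
structure Stage (R : Type u) [CommRing R] (n : ℕ) : Type (max (u + 1) (v + 1)) where
  basis : Type v
  deg : basis → Fin n → ℤ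
  rel : Submodule (MvPolynomial (Fin n) R) (basis →₀ MvPolynomial (Fin n) R)

variable (R : Type u) [CommRing R] {n : ℕ} {N : Type w} [AddCommGroup N]
  [Module (MvPolynomial (Fin n) R) N]

/-- The map from the free module on the nonzero homogeneous elements of `N` to `N`. -/
noncomputable def coverMap (𝓝 : (Fin n → ℤ) → AddSubgroup N) :
    (HomGen R 𝓝 →₀ MvPolynomial (Fin n) R) →ₗ[MvPolynomial (Fin n) R] N :=
  Finsupp.linearCombination _ HomGen.val

/-- The free module on the nonzero homogeneous elements of `N`, with the first syzygies of `N`. -/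
noncomputable def cover (𝓝 : (Fin n → ℤ) → AddSubgroup N) : Stage.{u, max u w} R n where
  basis := HomGen R 𝓝
  deg := HomGen.deg
  rel := LinearMap.ker (coverMap R 𝓝)

variable {R} in
/-- The grading induced on the submodule in a stage. -/
noncomputable def Stage.relGrading (P : Stage.{u, v} R n) (a : Fin n → ℤ) : AddSubgroup P.rel :=
  (freeGrading R P.deg a).comap P.rel.subtype.toAddMonoidHom

/-- The standard graded free resolution of `N`: the modules `P_0, P_1, …`, each with its submodule
of relations, where `P_{k+1}` is the free module on the nonzero homogeneous elements of the
relations in `P_k`. -/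
noncomputable def stage (𝓝 : (Fin n → ℤ) → AddSubgroup N) : ℕ → Stage.{u, max u w} R n
  | 0 => cover R 𝓝
  | k + 1 => cover R (stage 𝓝 k).relGrading

/-- The `k`-th free module `P_k` of the standard graded free resolution of `N`. -/
abbrev Res (𝓝 : (Fin n → ℤ) → AddSubgroup N) (k : ℕ) : Type (max u w) :=
  (stage R 𝓝 k).basis →₀ MvPolynomial (Fin n) R

/-- The grading of `P_k`. -/
noncomputable def resGrading (𝓝 : (Fin n → ℤ) → AddSubgroup N) (k : ℕ) :
    (Fin n → ℤ) → AddSubgroup (Res R 𝓝 k) :=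
  freeGrading R (stage R 𝓝 k).deg

/-- The differential `P_{k+1} → P_k`. -/
noncomputable def resD (𝓝 : (Fin n → ℤ) → AddSubgroup N) (k : ℕ) :
    Res R 𝓝 (k + 1) →ₗ[MvPolynomial (Fin n) R] Res R 𝓝 k :=
  (stage R 𝓝 k).rel.subtype ∘ₗ coverMap R (stage R 𝓝 k).relGrading

end Resolution

section Exactness

variable {R : Type u} [CommRing R] {n : ℕ}

/-- A family of projections onto the components of a graded module over the graded ring `S`. This is
used only in the proof that the standard graded free resolution is exact. -/
structure GradedProj {N : Type w} [AddCommGroup N] [Module (MvPolynomial (Fin n) R) N]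
    (𝓝 : (Fin n → ℤ) → AddSubgroup N) where
  proj : (Fin n → ℤ) → N →+ N
  proj_mem : ∀ a x, proj a x ∈ 𝓝 a
  proj_same : ∀ a, ∀ x ∈ 𝓝 a, proj a x = x
  proj_ne : ∀ a b, ∀ x ∈ 𝓝 b, b ≠ a → proj a x = 0
  sum_proj : ∀ x, ∃ s : Finset (Fin n → ℤ), ∑ a ∈ s, proj a x = x
  smul_mem : ∀ b a, ∀ p ∈ polyGrading R n b, ∀ x ∈ 𝓝 a, p • x ∈ 𝓝 (b + a)

variable {N : Type w} [AddCommGroup N] [Module (MvPolynomial (Fin n) R) N]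

theorem coverMap_surjective {𝓝 : (Fin n → ℤ) → AddSubgroup N} (π : GradedProj (R := R) 𝓝) :
    Function.Surjective (coverMap R 𝓝) := by
  intro x
  obtain ⟨s, hs⟩ := π.sum_proj x
  rw [← LinearMap.mem_range, ← hs]
  refine Submodule.sum_mem _ fun a _ => ?_
  by_cases h : π.proj a x = 0
  · rw [h]; exact Submodule.zero_mem _
  · exact ⟨Finsupp.single ⟨a, _, π.proj_mem a x, h⟩ 1, by simp [coverMap]⟩

/-- The projections of a decomposition. -/
noncomputable def GradedProj.ofDecomposition (𝓝 : (Fin n → ℤ) → AddSubgroup N)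
    [DirectSum.Decomposition 𝓝] [SetLike.GradedSMul (polyGrading R n) 𝓝] :
    GradedProj (R := R) 𝓝 where
  proj a := (𝓝 a).subtype.comp
    ((DFinsupp.evalAddMonoidHom a).comp (DirectSum.decomposeAddEquiv 𝓝).toAddMonoidHom)
  proj_mem a x := (DirectSum.decompose 𝓝 x a).2
  proj_same a x hx := DirectSum.decompose_of_mem_same 𝓝 hx
  proj_ne a b x hx hne := DirectSum.decompose_of_mem_ne 𝓝 hx hne
  sum_proj x := by
    classical
    exact ⟨_, DirectSum.sum_support_decompose 𝓝 x⟩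
  smul_mem b a p hp x hx := SetLike.GradedSMul.smul_mem hp hx

/-- The projection of a graded free module onto its component of degree `a`. -/
noncomputable def freeProj {ι : Type v} (deg : ι → Fin n → ℤ) (a : Fin n → ℤ) :
    (ι →₀ MvPolynomial (Fin n) R) →+ (ι →₀ MvPolynomial (Fin n) R) :=
  Finsupp.liftAddHom fun g => (Finsupp.singleAddHom g).comp
    (MvPolynomial.weightedHomogeneousComponent (eps (n := n)) (a - deg g)).toAddMonoidHom

theorem freeProj_apply {ι : Type v} (deg : ι → Fin n → ℤ) (a : Fin n → ℤ)
    (x : ι →₀ MvPolynomial (Fin n) R) (g : ι) : freeProj deg a x g =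
      MvPolynomial.weightedHomogeneousComponent (eps (n := n)) (a - deg g) (x g) := by
  classical
  induction x using Finsupp.induction_linear with
  | zero => simp
  | add f g hf hg => simp [map_add, hf, hg]
  | single h p =>
    by_cases e : h = g
    · subst e; simp [freeProj]
    · simp [freeProj, e]

/-- The projections of a graded free module. -/
noncomputable def GradedProj.free {ι : Type v} (deg : ι → Fin n → ℤ) :
    GradedProj (R := R) (freeGrading R deg) where
  proj a := freeProj deg a
  proj_mem a x g := by
    rw [freeProj_apply]
    exact MvPolynomial.weightedHomogeneousComponent_mem _ _ _
  proj_same a x hx := by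
    ext1 g
    rw [freeProj_apply]
    exact MvPolynomial.IsWeightedHomogeneous.weightedHomogeneousComponent_same (hx g)
  proj_ne a b x hx hne := by
    ext1 g
    rw [freeProj_apply]
    refine MvPolynomial.IsWeightedHomogeneous.weightedHomogeneousComponent_ne _ (hx g) ?_
    exact fun h => hne (sub_left_injective h).symm
  sum_proj x := by
    classical
    let s : Finset (Fin n → ℤ) := x.support.biUnion fun g =>
      (MvPolynomial.weightedHomogeneousComponent_finsupp (w := eps (n := n))
        (x g)).toFinset.image (· + deg g)
    refine ⟨s, ?_⟩
    ext1 g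
    rw [Finsupp.finsetSum_apply]
    simp only [freeProj_apply]
    by_cases hg : x g = 0
    · simp [hg]
    conv_rhs => rw [← MvPolynomial.sum_weightedHomogeneousComponent (eps (n := n)) (x g)]
    rw [finsum_eq_sum_of_support_subset (s := s.image (· - deg g))]
    · rw [Finset.sum_image fun a _ b _ h => sub_left_injective h]
    · intro m hm
      simp only [Finset.coe_image, Set.mem_image, Finset.mem_coe, s, Finset.mem_biUnion,
        Finset.mem_image]
      exact ⟨m + deg g, ⟨g, by simpa using hg, m, (Set.Finite.mem_toFinset _).2 hm, rfl⟩, by simp⟩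
  smul_mem b a p hp x hx g := by
    have h : b + a - deg g = b + (a - deg g) := by abel
    rw [h]
    exact MvPolynomial.IsWeightedHomogeneous.mul hp (hx g)

theorem coverMap_proj {𝓝 : (Fin n → ℤ) → AddSubgroup N} (π : GradedProj (R := R) 𝓝)
    (a : Fin n → ℤ) (f : HomGen R 𝓝 →₀ MvPolynomial (Fin n) R) :
    coverMap R 𝓝 (freeProj HomGen.deg a f) = π.proj a (coverMap R 𝓝 f) := by
  classical
  induction f using Finsupp.induction_linear with
  | zero => simp
  | add f g hf hg => simp only [map_add, hf, hg]
  | single g p =>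
    have h1 : freeProj HomGen.deg a (Finsupp.single g p) = Finsupp.single g
        (MvPolynomial.weightedHomogeneousComponent (eps (n := n)) (a - g.deg) p) := by
      simp [freeProj]
    rw [h1]
    simp only [coverMap, Finsupp.linearCombination_single]
    have hp := MvPolynomial.sum_weightedHomogeneousComponent (eps (n := n)) p
    have hfin := MvPolynomial.weightedHomogeneousComponent_finsupp (w := eps (n := n)) p
    rw [finsum_eq_sum_of_support_subset (s := insert (a - g.deg) hfin.toFinset) _
      (fun m hm => Finset.mem_insert_of_mem ((Set.Finite.mem_toFinset _).2 hm))] at hp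
    conv_rhs => rw [← hp, Finset.sum_smul, map_sum]
    rw [Finset.sum_eq_single_of_mem (a - g.deg) (Finset.mem_insert_self _ _)]
    · refine (π.proj_same _ _ ?_).symm
      have := π.smul_mem (a - g.deg) g.deg _
        (MvPolynomial.weightedHomogeneousComponent_mem _ p _) g.val g.mem
      rwa [sub_add_cancel] at this
    · intro b _ hb
      refine π.proj_ne _ (b + g.deg) _ ?_ ?_
      · exact π.smul_mem b g.deg _
          (MvPolynomial.weightedHomogeneousComponent_mem _ p _) g.val g.mem
      · exact fun h => hb (by rw [← h, add_sub_cancel_right])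

/-- The projections of the module of relations in a cover. -/
noncomputable def GradedProj.rel {𝓝 : (Fin n → ℤ) → AddSubgroup N} (π : GradedProj (R := R) 𝓝) :
    GradedProj (R := R) (cover R 𝓝).relGrading where
  proj a := ((freeProj HomGen.deg a).comp
      (cover R 𝓝).rel.subtype.toAddMonoidHom).codRestrict (cover R 𝓝).rel.toAddSubgroup
        fun x => by
    have hx : coverMap R 𝓝 x.1 = 0 := x.2
    change coverMap R 𝓝 _ = 0
    exact (coverMap_proj π a x.1).trans (by rw [hx, map_zero])
  proj_mem a x := (GradedProj.free (R := R) HomGen.deg).proj_mem a x.1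
  proj_same a x hx := Subtype.ext ((GradedProj.free HomGen.deg).proj_same a x.1 hx)
  proj_ne a b x hx h := Subtype.ext ((GradedProj.free HomGen.deg).proj_ne a b x.1 hx h)
  sum_proj x := by
    obtain ⟨s, hs⟩ := (GradedProj.free HomGen.deg).sum_proj x.1
    refine ⟨s, Subtype.ext ?_⟩
    refine Eq.trans ?_ hs
    exact map_sum (cover R 𝓝).rel.subtype _ _
  smul_mem b a p hp x hx := (GradedProj.free HomGen.deg).smul_mem b a p hp x.1 hx

noncomputable def GradedProj.stageRel {𝓝 : (Fin n → ℤ) → AddSubgroup N}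
    (π : GradedProj (R := R) 𝓝) : (k : ℕ) → GradedProj (R := R) (stage R 𝓝 k).relGrading
  | 0 => π.rel
  | k + 1 => (GradedProj.stageRel π k).rel

/-- `⋯ → P_1 → P_0 → N → 0` is exact. -/
theorem res_exact (𝓝 : (Fin n → ℤ) → AddSubgroup N)
    [DirectSum.Decomposition 𝓝] [SetLike.GradedSMul (polyGrading R n) 𝓝] :
    Function.Surjective (coverMap R 𝓝) ∧ Function.Exact (resD R 𝓝 0) (coverMap R 𝓝) ∧
      ∀ k, Function.Exact (resD R 𝓝 (k + 1)) (resD R 𝓝 k) := by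
  have π := GradedProj.ofDecomposition (R := R) 𝓝
  have key : ∀ k x, x ∈ (stage R 𝓝 k).rel → ∃ y, resD R 𝓝 k y = x := fun k x hx => by
    obtain ⟨y, hy⟩ := coverMap_surjective (π.stageRel k) ⟨x, hx⟩
    exact ⟨y, congrArg Subtype.val hy⟩
  have mem : ∀ k y, resD R 𝓝 k y ∈ (stage R 𝓝 k).rel := fun k y =>
    (coverMap R (stage R 𝓝 k).relGrading y).2
  refine ⟨coverMap_surjective π, fun x => ⟨fun hx => key 0 x hx, ?_⟩,
    fun k x => ⟨fun hx => key (k + 1) x (Subtype.ext hx), ?_⟩⟩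
  · rintro ⟨y, rfl⟩
    exact mem 0 y
  · rintro ⟨y, rfl⟩
    exact congrArg Subtype.val (mem (k + 1) y)

end Exactness

section Tor

variable (R : Type u) [CommRing R] {n : ℕ} (A : Type v) {N : Type w} [AddCommGroup A]
  [AddCommGroup N] [Module (MvPolynomial (Fin n) R) A] [Module (MvPolynomial (Fin n) R) N]

/-- The differential `A ⊗_S P_{k+1} → A ⊗_S P_k`. -/
noncomputable def torD (𝓝 : (Fin n → ℤ) → AddSubgroup N) (k : ℕ) :
    (A ⊗[MvPolynomial (Fin n) R] Res R 𝓝 (k + 1)) →ₗ[MvPolynomial (Fin n) R]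
      (A ⊗[MvPolynomial (Fin n) R] Res R 𝓝 k) :=
  LinearMap.lTensor A (resD R 𝓝 k)

/-- The cycles of the complex `A ⊗_S P`. -/
noncomputable def torCycles (𝓝 : (Fin n → ℤ) → AddSubgroup N) : (i : ℕ) →
    Submodule (MvPolynomial (Fin n) R) (A ⊗[MvPolynomial (Fin n) R] Res R 𝓝 i)
  | 0 => ⊤
  | i + 1 => LinearMap.ker (torD R A 𝓝 i)

/-- The `S`-module `Tor_i^S(A, N) = H_i(A ⊗_S P)`, where `P` is the standard graded free resolution
of the graded `S`-module `N`. -/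
abbrev Tor (𝓝 : (Fin n → ℤ) → AddSubgroup N) (i : ℕ) : Type (max u v w) :=
  torCycles R A 𝓝 i ⧸ (LinearMap.range (torD R A 𝓝 i)).submoduleOf (torCycles R A 𝓝 i)

variable {A} in
/-- The component `Tor_i^S(A, N)_a`: the classes of the homogeneous cycles of degree `a`. -/
noncomputable def torDegree (𝓐 : (Fin n → ℤ) → AddSubgroup A) (𝓝 : (Fin n → ℤ) → AddSubgroup N)
    (i : ℕ) (a : Fin n → ℤ) : AddSubgroup (Tor R A 𝓝 i) :=
  ((tensorGrading (MvPolynomial (Fin n) R) 𝓐 (resGrading R 𝓝 i) a).comap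
      (torCycles R A 𝓝 i).subtype.toAddMonoidHom).map
    (Submodule.mkQ _).toAddMonoidHom

end Tor

end ZnGraded

namespace ZnGraded

/-! Write `E_F` for `S ⊗_{R[F]} M`, and let `s ∉ F`. Enlarging `R[F]` to `R[F ∪ {s}]` imposes on
`E_F` exactly the relations `X_s p ⊗ m = p ⊗ X_s m`, so `E_{F ∪ {s}}` is the cokernel of `X_s ⊗ 1 -
1 ⊗ X_s` on `E_F` (`exact_extendDiff_extendMap`). This endomorphism has degree `ε_s`, and it is
injective (`extendDiff_injective`): `S` is free over `R[F]` on the monomials in the other variables,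
and the coordinates of a kernel element satisfy `x_u = X_s x_{u + ε_s}`; iterating this leaves the
finite support, so `x = 0`.

The resulting short exact sequence stays exact after tensoring with the free modules of the
resolution `P` of `N` and after passing to degree `a`. Its long exact homology sequence
(`IsHomology.longExact`) is the fundamental exact sequence. That `Tor_i(E_F, N)_a` is the homology
of the degree `a` strand (`isHomology_torClass`) rests on projections onto the homogeneous
components, which replace arbitrary preimages by homogeneous ones.

For `F = ∅` the complex `E_∅ ⊗_S P` is `P ⊗_R M`. As `P` is an `R`-flat resolution of `N`, its
higher homology is `Tor^R(N, M)`, which vanishes when `M` or `N` is flat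
(`subsingleton_tor_extend_empty`). The lower bound on degrees survives because `S` lives in
nonnegative total degrees and the resolution uses only nonzero homogeneous generators. -/

/-! ### Homology of complexes of abelian groups and the long exact sequence -/

/-- An additive relation that is total and single-valued at `0` is the graph of a homomorphism. -/
theorem exists_addMonoidHom_of_rel {G H : Type*} [AddCommGroup G] [AddCommGroup H]
    (Γ : AddSubgroup (G × H)) (h_total : ∀ g, ∃ h, (g, h) ∈ Γ) (h_zero : ∀ h, (0, h) ∈ Γ → h = 0) :
    ∃ f : G →+ H, ∀ g h, (g, h) ∈ Γ ↔ f g = h := by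
  choose f hf using h_total
  have key : ∀ g h, (g, h) ∈ Γ → f g = h := fun g h hg => by
    have := Γ.sub_mem (hf g) hg
    rw [Prod.mk_sub_mk, sub_self] at this
    exact sub_eq_zero.1 (h_zero _ this)
  refine ⟨⟨⟨f, key _ _ Γ.zero_mem⟩, fun x y => key _ _ (Γ.add_mem (hf x) (hf y))⟩,
    fun g h => ⟨key g h, ?_⟩⟩
  rintro rfl
  exact hf g

/-- The cycles of a complex of abelian groups indexed by `ℕ`. -/
def cycles {K : ℕ → Type*} [∀ i, AddCommGroup (K i)] (d : ∀ i, K (i + 1) →+ K i) :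
    (i : ℕ) → AddSubgroup (K i)
  | 0 => ⊤
  | i + 1 => (d i).ker

/-- `H` is the homology of the complex `K`, by means of the maps `cls` that take a cycle to its
class. -/
structure IsHomology {K : ℕ → Type*} [∀ i, AddCommGroup (K i)] (d : ∀ i, K (i + 1) →+ K i)
    {H : ℕ → Type*} [∀ i, AddCommGroup (H i)] (cls : ∀ i, cycles d i →+ H i) : Prop where
  d_mem : ∀ i y, d i y ∈ cycles d i
  surjective : ∀ i, Function.Surjective (cls i)
  cls_eq_zero : ∀ i z, cls i z = 0 ↔ ∃ y, d i y = z

section LongExact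

variable {K L Q : ℕ → Type*} [∀ i, AddCommGroup (K i)] [∀ i, AddCommGroup (L i)]
  [∀ i, AddCommGroup (Q i)] {dK : ∀ i, K (i + 1) →+ K i} {dL : ∀ i, L (i + 1) →+ L i}
  {dQ : ∀ i, Q (i + 1) →+ Q i}
  {HK HL HQ : ℕ → Type*} [∀ i, AddCommGroup (HK i)] [∀ i, AddCommGroup (HL i)]
  [∀ i, AddCommGroup (HQ i)] {cK : ∀ i, cycles dK i →+ HK i} {cL : ∀ i, cycles dL i →+ HL i}
  {cQ : ∀ i, cycles dQ i →+ HQ i}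

theorem map_mem_cycles {f : ∀ i, K i →+ L i} (hf : ∀ i x, f i (dK i x) = dL i (f (i + 1) x)) (i : ℕ)
    {x : K i} (hx : x ∈ cycles dK i) : f i x ∈ cycles dL i := by
  cases i with
  | zero => exact AddSubgroup.mem_top _
  | succ i =>
    have hx : dK i x = 0 := hx
    change dL i _ = 0
    rw [← hf, hx, map_zero]

theorem mem_cycles_of_map {f : ∀ i, K i →+ L i} (hf : ∀ i x, f i (dK i x) = dL i (f (i + 1) x))
    (inj : ∀ i, Function.Injective (f i)) (i : ℕ)
    {x : K i} (hx : f i x ∈ cycles dL i) : x ∈ cycles dK i := by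
  cases i with
  | zero => exact AddSubgroup.mem_top _
  | succ i =>
    have hx : dL i (f (i + 1) x) = 0 := hx
    change dK i _ = 0
    apply inj
    rw [hf, hx, map_zero]

/-- The map is obtained from the relation of pairs (class of `x`, class of `f x`); only
single-valuedness at `0` has to be checked, and there `f` carries boundaries to boundaries. -/
theorem IsHomology.exists_map (hK : IsHomology dK cK) (hL : IsHomology dL cL) (f : ∀ i, K i →+ L i)
    (hf : ∀ i x, f i (dK i x) = dL i (f (i + 1) x)) (i : ℕ) :
    ∃ F : HK i →+ HL i, ∀ x (hx : x ∈ cycles dK i),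
      F (cK i ⟨x, hx⟩) = cL i ⟨f i x, map_mem_cycles hf i hx⟩ := by
  let g : cycles dK i →+ cycles dL i :=
    ((f i).comp (cycles dK i).subtype).codRestrict _ fun x => map_mem_cycles hf i x.2
  let Γ : AddSubgroup (HK i × HL i) := ((cK i).prod ((cL i).comp g)).range
  obtain ⟨F, hF⟩ := exists_addMonoidHom_of_rel Γ
    (fun y => by
      obtain ⟨x, rfl⟩ := hK.surjective i y
      exact ⟨_, x, rfl⟩)
    (by
      rintro h ⟨x, hx⟩
      obtain ⟨hx, rfl⟩ := Prod.ext_iff.1 hx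
      obtain ⟨y, hy⟩ := (hK.cls_eq_zero i x).1 hx
      refine (hL.cls_eq_zero i (g x)).2 ⟨f (i + 1) y, ?_⟩
      rw [← hf, hy]
      rfl)
  exact ⟨F, fun x hx => (hF _ _).1 ⟨⟨x, hx⟩, rfl⟩⟩

/-- Snake lemma, with the relation given by all zigzags `g l`, `l`, `dL l = f k`. The value of `π`
is prescribed on every zigzag, so later arguments may use whichever lift is convenient. -/
theorem IsHomology.exists_connecting (hK : IsHomology dK cK) (hL : IsHomology dL cL)
    (hQ : IsHomology dQ cQ) (f : ∀ i, K i →+ L i) (g : ∀ i, L i →+ Q i)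
    (hf : ∀ i x, f i (dK i x) = dL i (f (i + 1) x))
    (hg : ∀ i x, g i (dL i x) = dQ i (g (i + 1) x))
    (inj : ∀ i, Function.Injective (f i)) (ex : ∀ i, Function.Exact (f i) (g i))
    (surj : ∀ i, Function.Surjective (g i)) (i : ℕ) :
    ∃ π : HQ (i + 1) →+ HK i, ∀ (l : L (i + 1)) (hq : g _ l ∈ cycles dQ (i + 1)) (k : K i)
      (hk : k ∈ cycles dK i), f i k = dL i l → π (cQ _ ⟨_, hq⟩) = cK i ⟨k, hk⟩ := by
  let Γ : AddSubgroup (HQ (i + 1) × HK i) :=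
    { carrier := {p | ∃ (l : L (i + 1)) (hq : g _ l ∈ cycles dQ (i + 1)) (k : K i)
        (hk : k ∈ cycles dK i), f i k = dL i l ∧ cQ _ ⟨_, hq⟩ = p.1 ∧ cK i ⟨k, hk⟩ = p.2}
      zero_mem' := ⟨0, by rw [map_zero]; exact zero_mem _, 0, zero_mem _, by simp, by
        simp only [map_zero]; exact map_zero (cQ _), map_zero (cK i)⟩
      add_mem' := by
        rintro ⟨_, _⟩ ⟨_, _⟩ ⟨l, hq, k, hk, h, rfl, rfl⟩ ⟨l', hq', k', hk', h', rfl, rfl⟩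
        refine ⟨l + l', by rw [map_add]; exact add_mem hq hq', k + k', add_mem hk hk',
          by simp [h, h'], ?_, ?_⟩
        · simp only [map_add]
          exact map_add (cQ _) ⟨_, hq⟩ ⟨_, hq'⟩
        · exact map_add (cK i) ⟨_, hk⟩ ⟨_, hk'⟩
      neg_mem' := by
        rintro ⟨_, _⟩ ⟨l, hq, k, hk, h, rfl, rfl⟩
        refine ⟨-l, by rw [map_neg]; exact neg_mem hq, -k, neg_mem hk, by simp [h], ?_, ?_⟩
        · simp only [map_neg]
          exact map_neg (cQ _) ⟨_, hq⟩
        · exact map_neg (cK i) ⟨_, hk⟩ }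
  obtain ⟨π, hπ⟩ := exists_addMonoidHom_of_rel Γ
    (fun y => by
      obtain ⟨⟨q, hq⟩, rfl⟩ := hQ.surjective _ y
      obtain ⟨l, rfl⟩ := surj _ q
      have hq' : dQ i (g _ l) = 0 := hq
      obtain ⟨k, hk⟩ := (ex i (dL i l)).1 (by rw [hg, hq'])
      exact ⟨_, l, hq, k, mem_cycles_of_map hf inj i (hk ▸ hL.d_mem i l), hk, rfl, rfl⟩)
    (by
      rintro h ⟨l, hq, k, hk, hkl, h0, rfl⟩
      obtain ⟨q, hq'⟩ := (hQ.cls_eq_zero _ _).1 h0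
      obtain ⟨l', rfl⟩ := surj _ q
      rw [← hg] at hq'
      -- Subtracting a boundary from `l` leaves `dL l` unchanged, and the difference comes from `K`;
      -- hence `k` is a boundary in `K`.
      have h1 : g _ (l - dL _ l') = 0 := by rw [map_sub, hq', sub_self]
      obtain ⟨k', hk'⟩ := (ex _ _).1 h1
      refine (hK.cls_eq_zero i _).2 ⟨k', inj _ ?_⟩
      have h2 : dL i (dL (i + 1) l') = 0 := hL.d_mem (i + 1) l'
      rw [hf, hk', map_sub, h2, sub_zero, hkl])
  exact ⟨π, fun l hq k hk h => (hπ _ _).1 ⟨l, hq, k, hk, h, rfl, rfl⟩⟩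

/-- The long exact homology sequence of a short exact sequence of complexes. -/
theorem IsHomology.longExact (hK : IsHomology dK cK) (hL : IsHomology dL cL)
    (hQ : IsHomology dQ cQ) (f : ∀ i, K i →+ L i) (g : ∀ i, L i →+ Q i)
    (hf : ∀ i x, f i (dK i x) = dL i (f (i + 1) x))
    (hg : ∀ i x, g i (dL i x) = dQ i (g (i + 1) x))
    (inj : ∀ i, Function.Injective (f i)) (ex : ∀ i, Function.Exact (f i) (g i))
    (surj : ∀ i, Function.Surjective (g i)) :
    ∃ (iota : ∀ i, HL i →+ HQ i) (pi : ∀ i, HQ (i + 1) →+ HK i) (del : ∀ i, HK i →+ HL i),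
      (∀ i, Function.Exact (del i) (iota i)) ∧ Function.Surjective (iota 0) ∧
      (∀ i, Function.Exact (iota (i + 1)) (pi i)) ∧ (∀ i, Function.Exact (pi i) (del i)) := by
  choose del hdel using hK.exists_map hL f hf
  choose iota hiota using hL.exists_map hQ g hg
  choose pi hpi using hK.exists_connecting hL hQ f g hf hg inj ex surj
  refine ⟨iota, pi, del, fun i y => ?_, fun y => ?_, fun i y => ?_, fun i y => ?_⟩
  · constructor
    · obtain ⟨⟨l, hl⟩, rfl⟩ := hL.surjective i y
      intro h
      rw [hiota] at h
      obtain ⟨q, hq⟩ := (hQ.cls_eq_zero _ _).1 h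
      obtain ⟨l', rfl⟩ := surj _ q
      rw [← hg] at hq
      have h1 : g _ (l - dL _ l') = 0 := by rw [map_sub, hq, sub_self]
      obtain ⟨k, hk⟩ := (ex _ _).1 h1
      have hkc : k ∈ cycles dK i :=
        mem_cycles_of_map hf inj i (hk ▸ sub_mem hl (hL.d_mem i l'))
      refine ⟨cK i ⟨k, hkc⟩, ?_⟩
      rw [hdel, ← sub_eq_zero, ← map_sub, hL.cls_eq_zero]
      refine ⟨-l', ?_⟩
      change _ = f i k - l
      rw [hk, map_neg]
      abel
    · rintro ⟨x, rfl⟩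
      obtain ⟨⟨k, hk⟩, rfl⟩ := hK.surjective i x
      rw [hdel, hiota, hQ.cls_eq_zero]
      exact ⟨0, by simp [(ex i).apply_apply_eq_zero]⟩
  · obtain ⟨⟨q, hq⟩, rfl⟩ := hQ.surjective 0 y
    obtain ⟨l, rfl⟩ := surj _ q
    -- In homological degree `0` every chain is a cycle, so any lift defines a class.
    exact ⟨cL 0 ⟨l, AddSubgroup.mem_top _⟩, hiota _ _ _⟩
  · constructor
    · obtain ⟨⟨q, hq⟩, rfl⟩ := hQ.surjective _ y
      obtain ⟨l, rfl⟩ := surj _ q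
      intro h
      have hq' : dQ i (g _ l) = 0 := hq
      obtain ⟨k, hk⟩ := (ex i (dL i l)).1 (by rw [hg, hq'])
      rw [hpi i l hq k (mem_cycles_of_map hf inj i (hk ▸ hL.d_mem i l)) hk, hK.cls_eq_zero] at h
      obtain ⟨k', hk'⟩ := h
      have hk' : dK i k' = k := hk'
      -- The class of `g l` lifts once `l` is corrected, without changing `g l`, to a cycle.
      have hl : l - f _ k' ∈ cycles dL (i + 1) := by
        change dL i _ = 0
        rw [map_sub, ← hf, hk', hk, sub_self]
      refine ⟨cL _ ⟨_, hl⟩, ?_⟩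
      rw [hiota]
      congr 2
      rw [map_sub, (ex _).apply_apply_eq_zero, sub_zero]
    · rintro ⟨x, rfl⟩
      obtain ⟨⟨l, hl⟩, rfl⟩ := hL.surjective _ x
      have hl' : dL i l = 0 := hl
      rw [hiota, hpi i l _ 0 (zero_mem _) (by rw [hl', map_zero])]
      exact map_zero (cK i)
  · constructor
    · obtain ⟨⟨k, hk⟩, rfl⟩ := hK.surjective i y
      intro h
      rw [hdel, hL.cls_eq_zero] at h
      obtain ⟨l, hl⟩ := h
      have hq : g _ l ∈ cycles dQ (i + 1) := by
        change dQ i _ = 0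
        rw [← hg, hl]
        exact (ex i).apply_apply_eq_zero k
      exact ⟨cQ _ ⟨_, hq⟩, hpi i l hq k hk hl.symm⟩
    · rintro ⟨x, rfl⟩
      obtain ⟨⟨q, hq⟩, rfl⟩ := hQ.surjective _ x
      obtain ⟨l, rfl⟩ := surj _ q
      have hq' : dQ i (g _ l) = 0 := hq
      obtain ⟨k, hk⟩ := (ex i (dL i l)).1 (by rw [hg, hq'])
      rw [hpi i l hq k (mem_cycles_of_map hf inj i (hk ▸ hL.d_mem i l)) hk, hdel, hL.cls_eq_zero]
      exact ⟨l, hk.symm⟩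

end LongExact

/-! ### Short exact sequences with flat quotient -/

section Flat

variable {R : Type*} [CommRing R] {K P Q : Type*} [AddCommGroup K] [AddCommGroup P]
  [AddCommGroup Q] [Module R K] [Module R P] [Module R Q]

/-- This is `Tor_1(X, Q) = 0` as a chase in the grid with rows `G, L, X` and columns `K, P, Q`.
Flatness of `Q` makes `G ⊗ Q → L ⊗ Q` injective, and flatness of `L` makes `L ⊗ K → L ⊗ P`
injective. -/
theorem lTensor_injective_of_flat_presentation {X L G : Type*} [AddCommGroup X] [Module R X]
    [AddCommGroup L] [Module R L] [AddCommGroup G] [Module R G] [Module.Flat R L] [Module.Flat R Q]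
    {j : G →ₗ[R] L} {p : L →ₗ[R] X} (hj : Function.Injective j) (hjp : Function.Exact j p)
    (hp : Function.Surjective p) {f : K →ₗ[R] P} {g : P →ₗ[R] Q} (hf : Function.Injective f)
    (hfg : Function.Exact f g) (hg : Function.Surjective g) : Function.Injective (f.lTensor X) := by
  rw [injective_iff_map_eq_zero]
  intro z hz
  obtain ⟨z', rfl⟩ := LinearMap.rTensor_surjective K hp z
  rw [← LinearMap.comp_apply, LinearMap.lTensor_comp_rTensor, ← LinearMap.rTensor_comp_lTensor,
    LinearMap.comp_apply] at hz
  obtain ⟨y, hy⟩ := (rTensor_exact P hjp hp _).1 hz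
  have h1 : g.lTensor _ y = 0 := by
    apply Module.Flat.rTensor_preserves_injective_linearMap (M := Q) j hj
    rw [map_zero, ← LinearMap.comp_apply, LinearMap.rTensor_comp_lTensor,
      ← LinearMap.lTensor_comp_rTensor, LinearMap.comp_apply, hy]
    exact (lTensor_exact _ hfg hg).apply_apply_eq_zero _
  obtain ⟨x, rfl⟩ := (lTensor_exact _ hfg hg _).1 h1
  have h2 : z' = j.rTensor K x := by
    apply Module.Flat.lTensor_preserves_injective_linearMap (M := L) f hf
    rw [← hy, ← LinearMap.comp_apply, LinearMap.rTensor_comp_lTensor,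
      ← LinearMap.lTensor_comp_rTensor, LinearMap.comp_apply]
  rw [h2]
  exact (rTensor_exact K hjp hp).apply_apply_eq_zero x

/-- A short exact sequence with a flat quotient stays exact on the left under tensor products. -/
theorem lTensor_injective_of_flat_quotient (X : Type*) [AddCommGroup X] [Module R X]
    [Module.Flat R Q] {f : K →ₗ[R] P} {g : P →ₗ[R] Q} (hf : Function.Injective f)
    (hfg : Function.Exact f g) (hg : Function.Surjective g) : Function.Injective (f.lTensor X) :=
  -- The presentation of `X` is the free module on all its elements.
  lTensor_injective_of_flat_presentation (p := Finsupp.linearCombination R (id : X → X))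
    (Submodule.injective_subtype _) (LinearMap.exact_subtype_ker_map _)
    (Finsupp.linearCombination_id_surjective R X) hf hfg hg

/-- The kernel of a surjection of flat modules is flat. -/
theorem flat_of_shortExact [Module.Flat R P] [Module.Flat R Q]
    {f : K →ₗ[R] P} {g : P →ₗ[R] Q} (hf : Function.Injective f) (hfg : Function.Exact f g)
    (hg : Function.Surjective g) : Module.Flat R K := by
  rw [Module.Flat.iff_rTensor_injectiveₛ]
  intro A _ _ I
  let _ : AddCommGroup A := Module.addCommMonoidToAddCommGroup R
  have h1 := lTensor_injective_of_flat_quotient I hf hfg hg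
  have h2 :=
    Module.Flat.rTensor_preserves_injective_linearMap (M := P) I.subtype I.injective_subtype
  -- The composite `I ⊗ K → I ⊗ P → A ⊗ P` also factors through `A ⊗ K`, so its first factor `I ⊗ K
  -- → A ⊗ K` is injective.
  have h3 : Function.Injective (I.subtype.rTensor P ∘ₗ f.lTensor I) := by
    rw [LinearMap.coe_comp]
    exact h2.comp h1
  rw [LinearMap.rTensor_comp_lTensor, ← LinearMap.lTensor_comp_rTensor, LinearMap.coe_comp] at h3
  exact h3.of_comp

end Flat

/-! ### Monomial basis of `S` over `R[F]` and degrees of polynomials -/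

section Basis

variable (R : Type u) [CommRing R] {n : ℕ} (F : Finset (Fin n))

/-- The exponents of the monomials in the variables outside `F`. -/
def OffExp {n : ℕ} (F : Finset (Fin n)) : Type := {u : Fin n →₀ ℕ // ∀ j ∈ F, u j = 0}

variable {R F} in
theorem eq_zero_of_coeff_ne_zero {p : MvPolynomial (Fin n) R}
    (hp : p ∈ MvPolynomial.supported R (F : Set (Fin n))) {v : Fin n →₀ ℕ}
    (hv : p.coeff v ≠ 0) {j : Fin n} (hj : j ∉ F) : v j = 0 := by
  by_contra h
  exact hj (MvPolynomial.mem_supported.1 hp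
    ((MvPolynomial.mem_vars_iff_mem_support j).2
      ⟨v, MvPolynomial.mem_support_iff.2 hv, by simpa using h⟩))

variable {F} in
theorem monomial_mem_supported {v : Fin n →₀ ℕ} (hv : ∀ j ∉ F, v j = 0) (c : R) :
    MvPolynomial.monomial v c ∈ MvPolynomial.supported R (F : Set (Fin n)) := by
  classical
  rw [MvPolynomial.mem_supported]
  intro j hj
  by_contra h
  obtain ⟨d, hd, hjd⟩ := (MvPolynomial.mem_vars_iff_mem_support j).1 (Finset.mem_coe.1 hj)
  have := Finset.mem_singleton.1 (MvPolynomial.support_monomial_subset hd)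
  subst this
  exact (Finsupp.mem_support_iff.1 hjd) (hv j h)

/-- The part of an exponent outside `F`. -/
noncomputable def offPart (m : Fin n →₀ ℕ) : OffExp F :=
  ⟨m.filter (· ∉ F), fun _ hj => Finsupp.filter_apply_neg _ _ (by simpa using hj)⟩

/-- The part of a monomial inside `F`, as an element of `R[F]`. -/
noncomputable def onMonomial (m : Fin n →₀ ℕ) (c : R) :
    MvPolynomial.supported R (F : Set (Fin n)) :=
  ⟨MvPolynomial.monomial (m.filter (· ∈ F)) c,
    monomial_mem_supported R (fun _ hj => Finsupp.filter_apply_neg _ _ hj) c⟩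

theorem onMonomial_smul (m : Fin n →₀ ℕ) (c : R) :
    onMonomial R F m c • MvPolynomial.monomial (offPart F m).1 (1 : R) =
      MvPolynomial.monomial m c := by
  change MvPolynomial.monomial _ c * MvPolynomial.monomial _ 1 = _
  rw [MvPolynomial.monomial_mul, mul_one]
  congr 2
  exact Finsupp.filter_add_filter_not m (· ∈ F)

/-- An exponent splits uniquely into a part on `F` and a part off `F`. Hence the coefficient of a
linear combination at `v + u`, with `v` supported on `F`, is the coefficient of `l u` at `v`. -/
theorem linearIndependent_offMonomial : LinearIndependent
    (MvPolynomial.supported R (F : Set (Fin n)))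
    (fun u : OffExp F => MvPolynomial.monomial u.1 (1 : R)) := by
  classical
  rw [linearIndependent_iff]
  intro l hl
  ext u v
  by_contra hne
  change (l u : MvPolynomial (Fin n) R).coeff v ≠ 0 at hne
  have hv : ∀ j ∉ F, v j = 0 := fun j hj => eq_zero_of_coeff_ne_zero (l u).2 hne hj
  have h := congrArg (MvPolynomial.coeff (v + u.1)) hl
  rw [Finsupp.linearCombination_apply, Finsupp.sum, MvPolynomial.coeff_sum,
    Finset.sum_eq_single u] at h
  · change MvPolynomial.coeff _ ((l u : MvPolynomial (Fin n) R) * _) = _ at h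
    rw [MvPolynomial.coeff_mul_monomial, mul_one] at h
    exact hne h
  -- A contribution from `u'` requires `v + u - u'` to vanish off `F`, where `v` does too. Together
  -- with `u' ≤ v + u`, this forces `u' = u` off `F`, and on `F` both are zero.
  · intro u' _ hu'
    change MvPolynomial.coeff _ ((l u' : MvPolynomial (Fin n) R) * _) = _
    rw [MvPolynomial.coeff_mul_monomial']
    split_ifs with hle
    · by_contra hc
      rw [mul_one] at hc
      refine hu' (Subtype.ext (Finsupp.ext fun j => ?_))
      by_cases hj : j ∈ F
      · rw [u.2 j hj, u'.2 j hj]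
      · have h1 := eq_zero_of_coeff_ne_zero (l u').2 hc hj
        have h2 := hle j
        have h3 := hv j hj
        simp only [Finsupp.coe_tsub, Pi.sub_apply, Finsupp.coe_add, Pi.add_apply] at h1 h2
        omega
    · rfl
  · intro hu
    rw [Finsupp.notMem_support_iff.1 hu, zero_smul, MvPolynomial.coeff_zero]

/-- The monomials in the variables outside `F` form a basis of `S` over `R[F]`. -/
noncomputable def offBasis : Module.Basis (OffExp F) (MvPolynomial.supported R (F : Set (Fin n)))
    (MvPolynomial (Fin n) R) :=
  Module.Basis.mk (linearIndependent_offMonomial R F) (by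
    rintro p -
    induction p using MvPolynomial.induction_on' with
    | monomial m c =>
      rw [← onMonomial_smul R F]
      exact Submodule.smul_mem _ _ (Submodule.subset_span ⟨_, rfl⟩)
    | add p q hp hq => exact add_mem hp hq)

theorem offBasis_apply (u : OffExp F) : offBasis R F u = MvPolynomial.monomial u.1 1 :=
  Module.Basis.mk_apply _ _ _

theorem offBasis_repr_monomial (m : Fin n →₀ ℕ) (c : R) :
    (offBasis R F).repr (MvPolynomial.monomial m c) =
      Finsupp.single (offPart F m) (onMonomial R F m c) := by
  rw [← onMonomial_smul R F m c, ← offBasis_apply, map_smul, Module.Basis.repr_self,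
    Finsupp.smul_single, smul_eq_mul, mul_one]

variable {R}

theorem monomial_mem_polyGrading (m : Fin n →₀ ℕ) (c : R) :
    MvPolynomial.monomial m c ∈ polyGrading R n (Finsupp.weight eps m) :=
  MvPolynomial.isWeightedHomogeneous_monomial _ _ _ rfl

theorem X_mem_polyGrading (s : Fin n) : (MvPolynomial.X s : MvPolynomial (Fin n) R) ∈
    polyGrading R n (eps s) :=
  MvPolynomial.isWeightedHomogeneous_X _ _ _

theorem mul_mem_polyGrading {p q : MvPolynomial (Fin n) R} {b c : Fin n → ℤ}
    (hp : p ∈ polyGrading R n b) (hq : q ∈ polyGrading R n c) : p * q ∈ polyGrading R n (b + c) :=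
  MvPolynomial.IsWeightedHomogeneous.mul hp hq

/-- Each monomial of `p` has a single nonzero coordinate, namely its part on `F`, whose weight is
`b` minus the weight of the part off `F`. -/
theorem offBasis_repr_mem {p : MvPolynomial (Fin n) R} {b : Fin n → ℤ} (hp : p ∈ polyGrading R n b)
    (u : OffExp F) : ((offBasis R F).repr p u : MvPolynomial (Fin n) R) ∈
      polyGrading R n (b - Finsupp.weight eps u.1) := by
  classical
  rw [← MvPolynomial.support_sum_monomial_coeff p, map_sum, Finsupp.finsetSum_apply,
    AddSubmonoidClass.coe_finsetSum]
  refine Submodule.sum_mem _ fun m hm => ?_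
  have hm' : Finsupp.weight eps m = b := hp (MvPolynomial.mem_support_iff.1 hm)
  rw [offBasis_repr_monomial, Finsupp.single_apply]
  split_ifs with h
  · have := monomial_mem_polyGrading (m.filter (· ∈ F)) (p.coeff m)
    have h2 : b = Finsupp.weight eps (m.filter (· ∈ F)) + Finsupp.weight eps u.1 := by
      rw [← map_add, ← h, ← hm']
      congr 1
      exact (Finsupp.filter_add_filter_not m (· ∈ F)).symm
    rwa [h2, add_sub_cancel_right]
  · exact zero_mem _

theorem totalDegree_add (a b : Fin n → ℤ) : totalDegree (a + b) = totalDegree a + totalDegree b :=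
  Finset.sum_add_distrib

theorem totalDegree_weight_nonneg (m : Fin n →₀ ℕ) : 0 ≤ totalDegree (Finsupp.weight eps m) := by
  have h : ∀ s : Fin n, 0 ≤ totalDegree (eps s) := fun s =>
    Finset.sum_nonneg fun j _ => by
      by_cases h : j = s <;> simp [eps, h]
  induction m using Finsupp.induction_linear with
  | zero => simp [totalDegree]
  | add f g hf hg => rw [map_add, totalDegree_add]; exact add_nonneg hf hg
  | single s k =>
    have : totalDegree (k • eps s) = k • totalDegree (eps s) := by
      simp [totalDegree, Finset.mul_sum]
    rw [Finsupp.weight_single, this]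
    exact nsmul_nonneg (h s) k

theorem totalDegree_nonneg {p : MvPolynomial (Fin n) R} {b : Fin n → ℤ}
    (hp : p ∈ polyGrading R n b) (h : p ≠ 0) : 0 ≤ totalDegree b := by
  obtain ⟨m, hm⟩ := MvPolynomial.ne_zero_iff.1 h
  rw [← hp hm]
  exact totalDegree_weight_nonneg m

end Basis

/-! ### Projections onto homogeneous components -/

section Proj

variable {n : ℕ} {A B C : Type*} [AddCommGroup A] [AddCommGroup B] [AddCommGroup C]

/-- Projections onto the components of a graded abelian group. -/
structure Proj (𝓐 : (Fin n → ℤ) → AddSubgroup A) where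
  proj : (Fin n → ℤ) → A →+ A
  proj_same : ∀ a, ∀ x ∈ 𝓐 a, proj a x = x
  proj_ne : ∀ a b, ∀ x ∈ 𝓐 b, b ≠ a → proj a x = 0
  iSup_eq_top : ⨆ a, 𝓐 a = ⊤

variable {𝓐 : (Fin n → ℤ) → AddSubgroup A} {𝓑 : (Fin n → ℤ) → AddSubgroup B}
  {𝓒 : (Fin n → ℤ) → AddSubgroup C}

theorem homogeneous_induction (h : ⨆ a, 𝓐 a = ⊤) {p : A → Prop} (mem : ∀ a, ∀ x ∈ 𝓐 a, p x)
    (add : ∀ x y, p x → p y → p (x + y)) (x : A) : p x :=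
  AddSubgroup.iSup_induction 𝓐 (C := p) (h ▸ AddSubgroup.mem_top x) mem (mem 0 0 (zero_mem _)) add

theorem Proj.proj_mem (π : Proj 𝓐) (a : Fin n → ℤ) (x : A) : π.proj a x ∈ 𝓐 a := by
  induction x using homogeneous_induction π.iSup_eq_top with
  | mem b x hx =>
    by_cases h : b = a
    · subst h; rwa [π.proj_same _ _ hx]
    · rw [π.proj_ne a b x hx h]; exact zero_mem _
  | add x y hx hy => rw [map_add]; exact add_mem hx hy

/-- Homogeneous maps commute with the projections. -/
theorem Proj.map_proj (π : Proj 𝓐) (ρ : Proj 𝓑) (f : A →+ B) (d : Fin n → ℤ)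
    (hf : ∀ b, ∀ x ∈ 𝓐 b, f x ∈ 𝓑 (b + d)) (a : Fin n → ℤ) (x : A) :
    f (π.proj a x) = ρ.proj (a + d) (f x) := by
  induction x using homogeneous_induction π.iSup_eq_top with
  | mem b x hx =>
    by_cases h : b = a
    · subst h; rw [π.proj_same _ _ hx, ρ.proj_same _ _ (hf _ _ hx)]
    · rw [π.proj_ne a b x hx h, map_zero,
        ρ.proj_ne _ _ _ (hf _ _ hx) fun e => h (add_right_cancel e)]
  | add x y hx hy => simp only [map_add, hx, hy]

/-- A homogeneous element of the image of a homogeneous map is the image of a homogeneous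
element. -/
theorem Proj.exists_mem_map_eq (π : Proj 𝓐) (ρ : Proj 𝓑) (f : A →+ B) (d : Fin n → ℤ)
    (hf : ∀ b, ∀ x ∈ 𝓐 b, f x ∈ 𝓑 (b + d)) (a : Fin n → ℤ) (x : A) (hx : f x ∈ 𝓑 (a + d)) :
    ∃ y ∈ 𝓐 a, f y = f x :=
  ⟨π.proj a x, π.proj_mem a x, by rw [π.map_proj ρ f d hf, ρ.proj_same _ _ hx]⟩

/-- Componentwise projections of finitely supported functions, with shifted degrees. -/
noncomputable def finsuppProj {κ : Type*} (π : Proj 𝓒) (deg : κ → Fin n → ℤ) (a : Fin n → ℤ) :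
    (κ →₀ C) →+ (κ →₀ C) :=
  Finsupp.liftAddHom fun k => (Finsupp.singleAddHom k).comp (π.proj (a - deg k))

theorem finsuppProj_apply {κ : Type*} (π : Proj 𝓒) (deg : κ → Fin n → ℤ) (a : Fin n → ℤ)
    (x : κ →₀ C) (k : κ) : finsuppProj π deg a x k = π.proj (a - deg k) (x k) := by
  classical
  induction x using Finsupp.induction_linear with
  | zero => simp
  | add f g hf hg => simp [map_add, hf, hg]
  | single h p =>
    by_cases e : h = k
    · subst e; simp [finsuppProj]
    · simp [finsuppProj, e]

theorem tmul_mem_tensorGrading {T : Type*} [CommRing T] [Module T A] [Module T B]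
    {a b c : Fin n → ℤ} (h : b + c = a) {x : A} (hx : x ∈ 𝓐 b) {y : B} (hy : y ∈ 𝓑 c) :
    x ⊗ₜ[T] y ∈ tensorGrading T 𝓐 𝓑 a :=
  AddSubgroup.subset_closure ⟨b, c, h, x, hx, y, hy, rfl⟩

theorem iSup_tensorGrading {T : Type*} [CommRing T] [Module T A] [Module T B]
    (h𝓐 : ⨆ a, 𝓐 a = ⊤) (h𝓑 : ⨆ a, 𝓑 a = ⊤) : ⨆ a, tensorGrading T 𝓐 𝓑 a = ⊤ := by
  rw [eq_top_iff]
  rintro t -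
  induction t using TensorProduct.induction_on with
  | zero => exact zero_mem _
  | add x y hx hy => exact add_mem hx hy
  | tmul x y =>
    induction x using homogeneous_induction h𝓐 with
    | add x x' hx hx' => rw [TensorProduct.add_tmul]; exact add_mem hx hx'
    | mem b x hx =>
      induction y using homogeneous_induction h𝓑 with
      | add y y' hy hy' => rw [TensorProduct.tmul_add]; exact add_mem hy hy'
      | mem c y hy => exact AddSubgroup.mem_iSup_of_mem (b + c) (tmul_mem_tensorGrading rfl hx hy)

/-- The graded pieces are generated by homogeneous pure tensors, so this reduces all later degree
checks to such tensors. -/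
theorem map_mem_of_tensorGrading {T : Type*} [CommRing T] [Module T A] [Module T B]
    (f : A ⊗[T] B →+ C) (d : Fin n → ℤ)
    (hf : ∀ b c, ∀ x ∈ 𝓐 b, ∀ y ∈ 𝓑 c, f (x ⊗ₜ y) ∈ 𝓒 (b + c + d)) (a : Fin n → ℤ)
    (t : A ⊗[T] B) (ht : t ∈ tensorGrading T 𝓐 𝓑 a) : f t ∈ 𝓒 (a + d) := by
  suffices tensorGrading T 𝓐 𝓑 a ≤ (𝓒 (a + d)).comap f from this ht
  refine (AddSubgroup.closure_le _).2 ?_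
  rintro _ ⟨b, c, rfl, x, hx, y, hy, rfl⟩
  exact hf b c x hx y hy

/-- The projections of a tensor product that is a direct sum of shifted copies of a graded
group. -/
noncomputable def Proj.tensor {T : Type*} [CommRing T] [Module T A] [Module T B] {κ : Type*}
    (e : A ⊗[T] B ≃+ (κ →₀ C)) (deg : κ → Fin n → ℤ) (π : Proj 𝓒)
    (h𝓐 : ⨆ a, 𝓐 a = ⊤) (h𝓑 : ⨆ a, 𝓑 a = ⊤)
    (he : ∀ b c, ∀ x ∈ 𝓐 b, ∀ y ∈ 𝓑 c, ∀ k, e (x ⊗ₜ y) k ∈ 𝓒 (b + c - deg k)) :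
    Proj (tensorGrading T 𝓐 𝓑) :=
  -- Coordinates of homogeneous elements are homogeneous, so projecting coordinatewise does what is
  -- required.
  have he' (a : Fin n → ℤ) (t) (ht : t ∈ tensorGrading T 𝓐 𝓑 a) (k : κ) :
      e t k ∈ 𝓒 (a - deg k) :=
    map_mem_of_tensorGrading ((Finsupp.applyAddHom k).comp e.toAddMonoidHom) (-deg k)
      (fun b c x hx y hy => by rw [← sub_eq_add_neg]; exact he b c x hx y hy k) a t ht
  { proj a := e.symm.toAddMonoidHom.comp ((finsuppProj π deg a).comp e.toAddMonoidHom)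
    proj_same a t ht := by
      refine (AddEquiv.symm_apply_eq e).2 (Finsupp.ext fun k => ?_)
      change finsuppProj π deg a (e t) k = _
      rw [finsuppProj_apply, π.proj_same _ _ (he' a t ht k)]
    proj_ne a b t ht hne := by
      refine (AddEquiv.symm_apply_eq e).2 (Finsupp.ext fun k => ?_)
      change finsuppProj π deg a (e t) k = _
      rw [finsuppProj_apply, π.proj_ne _ _ _ (he' b t ht k) fun h => hne (sub_left_injective h),
        map_zero, Finsupp.zero_apply]
    iSup_eq_top := iSup_tensorGrading h𝓐 h𝓑 }

end Proj

/-! ### Projections for `S ⊗_{R[F]} M` and for tensor products with graded free modules -/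

section Modules

variable {R : Type u} [CommRing R] {n : ℕ}

theorem GradedProj.iSup_eq_top {N : Type w} [AddCommGroup N] [Module (MvPolynomial (Fin n) R) N]
    {𝓝 : (Fin n → ℤ) → AddSubgroup N} (π : GradedProj (R := R) 𝓝) : ⨆ a, 𝓝 a = ⊤ := by
  rw [eq_top_iff]
  rintro x -
  obtain ⟨s, hs⟩ := π.sum_proj x
  rw [← hs]
  exact sum_mem fun a _ => AddSubgroup.mem_iSup_of_mem a (π.proj_mem a x)

/-- The projections underlying those of a graded module. -/
def GradedProj.toProj {N : Type w} [AddCommGroup N] [Module (MvPolynomial (Fin n) R) N]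
    {𝓝 : (Fin n → ℤ) → AddSubgroup N} (π : GradedProj (R := R) 𝓝) : Proj 𝓝 :=
  ⟨π.proj, π.proj_same, π.proj_ne, π.iSup_eq_top⟩

theorem iSup_polyGrading :
    ⨆ a : Fin n → ℤ, (polyGrading R n a).toAddSubgroup = ⊤ := by
  rw [eq_top_iff]
  rintro p -
  induction p using MvPolynomial.induction_on' with
  | monomial m c => exact AddSubgroup.mem_iSup_of_mem _ (monomial_mem_polyGrading m c)
  | add p q hp hq => exact add_mem hp hq

variable {M : Type v} [AddCommGroup M] [Module (MvPolynomial (Fin n) R) M]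
  {𝓜 : (Fin n → ℤ) → AddSubgroup M}

/-- The coordinates of `S ⊗_{R[F]} M` with respect to the monomials in the variables outside `F`. -/
noncomputable def extendEquiv (R : Type u) [CommRing R] {n : ℕ} (M : Type v) [AddCommGroup M]
    [Module (MvPolynomial (Fin n) R) M] (F : Finset (Fin n)) : Extend R M F ≃+ (OffExp F →₀ M) :=
  open Classical in
  (TensorProduct.equivFinsuppOfBasisLeft (offBasis R F)).toAddEquiv

theorem extendEquiv_tmul (F : Finset (Fin n)) (p : MvPolynomial (Fin n) R) (m : M) (u : OffExp F) :
    extendEquiv R M F (p ⊗ₜ m) u = ((offBasis R F).repr p u : MvPolynomial (Fin n) R) • m := by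
  classical
  exact TensorProduct.equivFinsuppOfBasisLeft_apply_tmul_apply _ _ _ _

/-- The projections of `S ⊗_{R[F]} M`. -/
noncomputable def Proj.extend (π : GradedProj (R := R) 𝓜) (F : Finset (Fin n)) :
    Proj (extendGrading R 𝓜 F) :=
  Proj.tensor (extendEquiv R M F) (fun u => Finsupp.weight eps u.1) π.toProj iSup_polyGrading
    π.iSup_eq_top fun b c p hp m hm u => by
      rw [extendEquiv_tmul, add_sub_right_comm]
      exact π.smul_mem _ _ _ (offBasis_repr_mem F hp u) _ hm

theorem smul_mem_extendGrading {F : Finset (Fin n)} {b c : Fin n → ℤ} {p : MvPolynomial (Fin n) R}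
    (hp : p ∈ polyGrading R n b) {x : Extend R M F} (hx : x ∈ extendGrading R 𝓜 F c) :
    p • x ∈ extendGrading R 𝓜 F (b + c) := by
  rw [add_comm]
  refine map_mem_of_tensorGrading (DistribSMul.toAddMonoidHom _ p) b
    (fun d e q hq m hm => ?_) c x hx
  change p • (q ⊗ₜ m) ∈ _
  rw [TensorProduct.smul_tmul']
  exact tmul_mem_tensorGrading (by abel) (mul_mem_polyGrading hp hq) hm

/-- The projections of the tensor product of a graded module with a graded free module. -/
noncomputable def Proj.tensorFree {A : Type v} [AddCommGroup A] [Module (MvPolynomial (Fin n) R) A]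
    {𝓐 : (Fin n → ℤ) → AddSubgroup A} (π : Proj 𝓐)
    (smul_mem : ∀ b c, ∀ p ∈ polyGrading R n b, ∀ x ∈ 𝓐 c, p • x ∈ 𝓐 (b + c))
    {ι : Type w} (deg : ι → Fin n → ℤ) :
    Proj (tensorGrading (MvPolynomial (Fin n) R) 𝓐 (freeGrading R deg)) :=
  letI := Classical.decEq ι
  Proj.tensor (TensorProduct.equivFinsuppOfBasisRight
      (Finsupp.basisSingleOne (R := MvPolynomial (Fin n) R))).toAddEquiv deg π
    π.iSup_eq_top (GradedProj.free deg).iSup_eq_top fun b c x hx f hf g => by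
      have h : b + c - deg g = c - deg g + b := by abel
      rw [h]
      exact (TensorProduct.equivFinsuppOfBasisRight_apply_tmul_apply
        (Finsupp.basisSingleOne (R := MvPolynomial (Fin n) R)) x f g) ▸ smul_mem _ _ _ (hf g) _ hx

end Modules

/-! ### The short exact sequence relating `F` and `F ∪ {s}` -/

section Koszul

variable (R : Type u) [CommRing R] {n : ℕ} (M : Type v) [AddCommGroup M]
  [Module (MvPolynomial (Fin n) R) M] (F : Finset (Fin n)) (s : Fin n)

/-- The endomorphism `X_s ⊗ 1 - 1 ⊗ X_s` of `S ⊗_{R[F]} M`. -/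
noncomputable def extendDiff : Extend R M F →ₗ[MvPolynomial (Fin n) R] Extend R M F :=
  (MvPolynomial.X s : MvPolynomial (Fin n) R) • LinearMap.id -
    ((LinearMap.lsmul (MvPolynomial (Fin n) R) M (MvPolynomial.X s)).restrictScalars
      (MvPolynomial.supported R (F : Set (Fin n)))).baseChange (MvPolynomial (Fin n) R)

variable {M} in
theorem extendDiff_tmul (p : MvPolynomial (Fin n) R) (m : M) :
    extendDiff R M F s (p ⊗ₜ m) =
      (MvPolynomial.X s * p) ⊗ₜ m - p ⊗ₜ ((MvPolynomial.X s : MvPolynomial (Fin n) R) • m) :=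
  rfl

theorem supported_le_insert : MvPolynomial.supported R (F : Set (Fin n)) ≤
    MvPolynomial.supported R ((insert s F : Finset (Fin n)) : Set (Fin n)) :=
  MvPolynomial.supported_mono (Finset.coe_subset.2 (Finset.subset_insert s F))

instance compatibleSMul_insert : TensorProduct.CompatibleSMul
    (MvPolynomial.supported R ((insert s F : Finset (Fin n)) : Set (Fin n)))
    (MvPolynomial.supported R (F : Set (Fin n))) (MvPolynomial (Fin n) R) M where
  smul_tmul t p m := TensorProduct.smul_tmul (R' := MvPolynomial.supported R
    ((insert s F : Finset (Fin n)) : Set (Fin n))) ⟨t.1, supported_le_insert R F s t.2⟩ p m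

/-- The canonical map `S ⊗_{R[F]} M → S ⊗_{R[F ∪ {s}]} M`. -/
noncomputable def extendMap : Extend R M F →ₗ[MvPolynomial (Fin n) R] Extend R M (insert s F) :=
  TensorProduct.mapOfCompatibleSMul _ _ _ _ _

variable {M} in
theorem extendMap_tmul (p : MvPolynomial (Fin n) R) (m : M) :
    extendMap R M F s (p ⊗ₜ m) = p ⊗ₜ m :=
  rfl

theorem extendMap_surjective : Function.Surjective (extendMap R M F s) :=
  TensorProduct.mapOfCompatibleSMul_surjective _ _ _ _ _

theorem extendMap_extendDiff (x : Extend R M F) : extendMap R M F s (extendDiff R M F s x) = 0 := by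
  induction x using TensorProduct.induction_on with
  | zero => simp
  | add x y hx hy => simp only [map_add, hx, hy, add_zero]
  | tmul p m =>
    rw [extendDiff_tmul, map_sub, extendMap_tmul, extendMap_tmul, sub_eq_zero]
    exact TensorProduct.smul_tmul (R' := MvPolynomial.supported R
      ((insert s F : Finset (Fin n)) : Set (Fin n)))
      ⟨MvPolynomial.X s, Algebra.subset_adjoin ⟨s, by simp, rfl⟩⟩ p m

/-- Induction over the algebra generators of `R[F ∪ {s}]`: for `X_s` the difference is a value of
`extendDiff`, for scalars and the other variables it is zero, and for products it telescopes through
`t' p ⊗ t m`. -/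
theorem mul_tmul_sub_mem_range {t : MvPolynomial (Fin n) R}
    (ht : t ∈ MvPolynomial.supported R ((insert s F : Finset (Fin n)) : Set (Fin n)))
    (p : MvPolynomial (Fin n) R) (m : M) :
    ((t * p) ⊗ₜ m - p ⊗ₜ (t • m) : Extend R M F) ∈ LinearMap.range (extendDiff R M F s) := by
  have base : ∀ t ∈ MvPolynomial.supported R (F : Set (Fin n)), ∀ p (m : M),
      ((t * p) ⊗ₜ m - p ⊗ₜ (t • m) : Extend R M F) ∈ LinearMap.range (extendDiff R M F s) := by
    intro t ht p m
    have h : ((t * p) ⊗ₜ m : Extend R M F) = p ⊗ₜ (t • m) :=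
      TensorProduct.smul_tmul (R' := MvPolynomial.supported R (F : Set (Fin n))) ⟨t, ht⟩ p m
    rw [h, sub_self]
    exact zero_mem _
  induction ht using Algebra.adjoin_induction generalizing p m with
  | mem t ht =>
    obtain ⟨j, hj, rfl⟩ := ht
    rcases Finset.mem_insert.1 (Finset.mem_coe.1 hj) with rfl | hj
    · exact ⟨p ⊗ₜ m, extendDiff_tmul R F j p m⟩
    · exact base _ (Algebra.subset_adjoin ⟨j, hj, rfl⟩) p m
  | algebraMap r => exact base _ (Subalgebra.algebraMap_mem _ r) p m
  | add t t' _ _ h h' =>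
    have := add_mem (h p m) (h' p m)
    rwa [sub_add_sub_comm, ← TensorProduct.add_tmul, ← TensorProduct.tmul_add, ← add_mul,
      ← add_smul] at this
  | mul t t' _ _ h h' =>
    have := add_mem (h (t' * p) m) (h' p (t • m))
    rwa [sub_add_sub_cancel, ← mul_assoc, ← mul_smul, mul_comm t' t] at this

/-- By `mul_tmul_sub_mem_range`, the quotient map `q` onto the cokernel of `extendDiff` is balanced
over `R[F ∪ {s}]`. It therefore factors as `σ` after `extendMap`, and whatever `extendMap` kills is
killed by `q`. -/
theorem exact_extendDiff_extendMap :
    Function.Exact (extendDiff R M F s) (extendMap R M F s) := by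
  intro x
  refine ⟨fun hx => ?_, ?_⟩
  swap
  · rintro ⟨y, rfl⟩
    exact extendMap_extendDiff R M F s y
  let q := (LinearMap.range (extendDiff R M F s)).mkQ
  let f : MvPolynomial (Fin n) R →+ M →+ (Extend R M F ⧸ LinearMap.range (extendDiff R M F s)) :=
    AddMonoidHom.mk' (fun p => AddMonoidHom.mk' (fun m => q (p ⊗ₜ m)) fun m m' => by
      rw [TensorProduct.tmul_add, map_add]) fun p p' => by
      ext m
      change q _ = q _ + q _
      rw [TensorProduct.add_tmul, map_add]
  let σ : Extend R M (insert s F) →+ _ := TensorProduct.liftAddHom f fun t p m => by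
    change q ((t.1 * p) ⊗ₜ m) = q (p ⊗ₜ (t.1 • m))
    rw [← sub_eq_zero, ← map_sub]
    exact (Submodule.Quotient.mk_eq_zero _).2 (mul_tmul_sub_mem_range R M F s t.2 p m)
  have hσ : ∀ y, σ (extendMap R M F s y) = q y := by
    intro y
    induction y using TensorProduct.induction_on with
    | zero => simp
    | add x y hx hy => simp only [map_add, hx, hy]
    | tmul p m => rfl
  have h := hσ x
  rw [hx, map_zero] at h
  exact (Submodule.Quotient.mk_eq_zero _).1 h.symm

section Injective

variable {F s}

/-- Multiplication of a monomial by `X_s`. -/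
noncomputable def OffExp.shift (hs : s ∉ F) (k : ℕ) (u : OffExp F) : OffExp F :=
  ⟨u.1 + Finsupp.single s k, fun j hj => by
    rw [Finsupp.add_apply, u.2 j hj, Finsupp.single_eq_of_ne (by rintro rfl; exact hs hj),
      add_zero]⟩

theorem OffExp.shift_left_injective (hs : s ∉ F) (u : OffExp F) :
    Function.Injective fun k => u.shift hs k := fun _ _ h =>
  Finsupp.single_injective s (add_left_cancel (congrArg Subtype.val h))

theorem OffExp.shift_injective (hs : s ∉ F) (k : ℕ) :
    Function.Injective (OffExp.shift hs k) := fun _ _ h =>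
  Subtype.ext (add_right_cancel (congrArg Subtype.val h))

variable {R M}

theorem extendEquiv_offBasis_tmul (u : OffExp F) (m : M) :
    extendEquiv R M F (offBasis R F u ⊗ₜ m) = Finsupp.single u m := by
  classical
  ext v
  rw [extendEquiv_tmul, Module.Basis.repr_self, Finsupp.single_apply, Finsupp.single_apply]
  split_ifs <;> simp

theorem extendEquiv_symm_single (u : OffExp F) (m : M) :
    (extendEquiv R M F).symm (Finsupp.single u m) = offBasis R F u ⊗ₜ m := by
  rw [AddEquiv.symm_apply_eq, extendEquiv_offBasis_tmul]

/-- In monomial coordinates `X_s ⊗ 1` shifts the index, as `s ∉ F`, while `1 ⊗ X_s` acts on the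
coefficients in `M`. -/
theorem extendEquiv_extendDiff (hs : s ∉ F) (x : Extend R M F) (u : OffExp F) :
    extendEquiv R M F (extendDiff R M F s x) (u.shift hs 1) = extendEquiv R M F x u -
      (MvPolynomial.X s : MvPolynomial (Fin n) R) • extendEquiv R M F x (u.shift hs 1) := by
  classical
  obtain ⟨f, rfl⟩ := (extendEquiv R M F).symm.surjective x
  rw [AddEquiv.apply_symm_apply]
  induction f using Finsupp.induction_linear with
  | zero => simp
  | add f g hf hg =>
    simp only [map_add, Finsupp.add_apply, smul_add, hf, hg]
    abel
  | single v m =>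
    have h : MvPolynomial.X s * offBasis R F v = offBasis R F (v.shift hs 1) := by
      rw [offBasis_apply, offBasis_apply, MvPolynomial.X, MvPolynomial.monomial_mul, mul_one,
        add_comm]
      rfl
    rw [extendEquiv_symm_single, extendDiff_tmul, h, map_sub, extendEquiv_offBasis_tmul,
      extendEquiv_offBasis_tmul, Finsupp.sub_apply, Finsupp.single_apply, Finsupp.single_apply,
      Finsupp.single_apply, Finsupp.single_apply, (OffExp.shift_injective hs 1).eq_iff]
    congr 1
    split_ifs <;> simp

theorem extendDiff_injective (hs : s ∉ F) : Function.Injective (extendDiff R M F s) := by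
  rw [injective_iff_map_eq_zero]
  intro x hx
  have step : ∀ u, extendEquiv R M F x u =
      (MvPolynomial.X s : MvPolynomial (Fin n) R) • extendEquiv R M F x (u.shift hs 1) := by
    intro u
    have := extendEquiv_extendDiff hs x u
    rw [hx, map_zero, Finsupp.zero_apply] at this
    exact (sub_eq_zero.1 this.symm)
  have iter : ∀ k u, extendEquiv R M F x u =
      (MvPolynomial.X s : MvPolynomial (Fin n) R) ^ k • extendEquiv R M F x (u.shift hs k) := by
    intro k
    induction k with
    | zero =>
      intro u
      have h : u.shift hs 0 = u := Subtype.ext (by simp [OffExp.shift])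
      rw [h, pow_zero, one_smul]
    | succ k ih =>
      intro u
      have h : (u.shift hs k).shift hs 1 = u.shift hs (k + 1) :=
        Subtype.ext (by simp [OffExp.shift, add_assoc])
      rw [ih, step (u.shift hs k), h, ← mul_smul, pow_succ]
  apply (extendEquiv R M F).injective
  rw [map_zero]
  ext u
  -- The support is finite and the shifts of `u` are distinct, so some shift lies outside it.
  obtain ⟨k, hk⟩ := ((extendEquiv R M F x).support.finite_toSet.preimage
    (OffExp.shift_left_injective hs u).injOn).infinite_compl.nonempty
  rw [iter k, Finsupp.notMem_support_iff.1 hk, smul_zero, Finsupp.zero_apply]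

end Injective

section Graded

variable {R M} {𝓜 : (Fin n → ℤ) → AddSubgroup M}

theorem extendDiff_mem (π : GradedProj (R := R) 𝓜) (b : Fin n → ℤ) (x : Extend R M F)
    (hx : x ∈ extendGrading R 𝓜 F b) :
    extendDiff R M F s x ∈ extendGrading R 𝓜 F (b + eps s) := by
  refine map_mem_of_tensorGrading (extendDiff R M F s).toAddMonoidHom (eps s)
    (fun c d p hp m hm => ?_) b x hx
  change extendDiff R M F s (p ⊗ₜ m) ∈ _
  rw [extendDiff_tmul]
  exact sub_mem
    (tmul_mem_tensorGrading (by abel) (mul_mem_polyGrading (X_mem_polyGrading s) hp) hm)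
    (tmul_mem_tensorGrading (by abel) hp (π.smul_mem _ _ _ (X_mem_polyGrading s) _ hm))

theorem extendMap_mem (b : Fin n → ℤ) (x : Extend R M F)
    (hx : x ∈ extendGrading R 𝓜 F b) :
    extendMap R M F s x ∈ extendGrading R 𝓜 (insert s F) b := by
  rw [← add_zero b]
  refine map_mem_of_tensorGrading (extendMap R M F s).toAddMonoidHom 0
    (fun c d p hp m hm => ?_) b x hx
  rw [add_zero]
  exact tmul_mem_tensorGrading rfl hp hm

end Graded

end Koszul

/-! ### Lower bounds on degrees -/

section Bounded

theorem tensorGrading_eq_bot {n : ℕ} {T : Type*} [CommRing T] {A B : Type*} [AddCommGroup A]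
    [AddCommGroup B] [Module T A] [Module T B] {𝓐 : (Fin n → ℤ) → AddSubgroup A}
    {𝓑 : (Fin n → ℤ) → AddSubgroup B} {c d : ℤ}
    (h𝓐 : ∀ b, ∀ x ∈ 𝓐 b, x ≠ 0 → c < totalDegree b)
    (h𝓑 : ∀ b, ∀ y ∈ 𝓑 b, y ≠ 0 → d ≤ totalDegree b)
    (a : Fin n → ℤ) (ha : totalDegree a ≤ c + d) : tensorGrading T 𝓐 𝓑 a = ⊥ := by
  rw [eq_bot_iff, tensorGrading, AddSubgroup.closure_le]
  rintro _ ⟨b, b', rfl, x, hx, y, hy, rfl⟩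
  rw [totalDegree_add] at ha
  by_cases h : x = 0
  · subst h; exact TensorProduct.zero_tmul _ _
  by_cases h' : y = 0
  · subst h'; exact TensorProduct.tmul_zero _ _
  have := h𝓐 b x hx h
  have := h𝓑 b' y hy h'
  omega

variable {R : Type u} [CommRing R] {n : ℕ}

/-- Generators are nonzero, so their degrees exceed `c`, and polynomial coefficients only raise the
degree. The bound thus passes unchanged to every step of the resolution. -/
theorem freeGrading_homGen_eq_bot {N : Type w} [AddCommGroup N] {𝓝 : (Fin n → ℤ) → AddSubgroup N}
    {c : ℤ} (h : ∀ a, totalDegree a ≤ c → 𝓝 a = ⊥) (a : Fin n → ℤ) (ha : totalDegree a ≤ c) :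
    freeGrading R (HomGen.deg (R := R) (𝓝 := 𝓝)) a = ⊥ := by
  rw [eq_bot_iff]
  intro f hf
  refine AddSubgroup.mem_bot.2 (Finsupp.ext fun g => ?_)
  by_contra hne
  have h1 := totalDegree_nonneg (hf g) hne
  have h2 : ¬ totalDegree g.deg ≤ c := fun hle =>
    g.ne_zero (AddSubgroup.mem_bot.1 (h _ hle ▸ g.mem))
  have h3 := totalDegree_add (a - g.deg) g.deg
  rw [sub_add_cancel] at h3
  omega

variable {N : Type w} [AddCommGroup N] [Module (MvPolynomial (Fin n) R) N]
  {𝓝 : (Fin n → ℤ) → AddSubgroup N} {c : ℤ}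

theorem Stage.relGrading_eq_bot {P : Stage.{u, v} R n} {a : Fin n → ℤ}
    (h : freeGrading R P.deg a = ⊥) : P.relGrading a = ⊥ := by
  rw [eq_bot_iff]
  intro x hx
  have hx : x.1 ∈ freeGrading R P.deg a := hx
  rw [h] at hx
  exact Subtype.ext hx

theorem resGrading_eq_bot (h : ∀ a, totalDegree a ≤ c → 𝓝 a = ⊥) (k : ℕ) :
    ∀ a, totalDegree a ≤ c → resGrading R 𝓝 k a = ⊥ := by
  induction k with
  | zero => exact freeGrading_homGen_eq_bot h
  | succ k ih =>
    exact freeGrading_homGen_eq_bot fun a ha => Stage.relGrading_eq_bot (ih a ha)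

theorem extendGrading_eq_bot {𝓝 : (Fin n → ℤ) → AddSubgroup N}
    (h : ∀ a, totalDegree a ≤ c → 𝓝 a = ⊥) (F : Finset (Fin n))
    (a : Fin n → ℤ) (ha : totalDegree a ≤ c) : extendGrading R 𝓝 F a = ⊥ := by
  -- Nonzero polynomials have total degree above `-1` and nonzero elements of the module have total
  -- degree at least `c + 1`; the two bounds add up to `c`.
  refine tensorGrading_eq_bot (c := -1) (d := c + 1) (fun b p hp hne => ?_) (fun b y hy hne => ?_) a
    (by omega)
  · have := totalDegree_nonneg hp hne
    omega
  · by_contra hlt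
    exact hne (AddSubgroup.mem_bot.1 (h b (by omega) ▸ hy))

end Bounded

/-! ### Graded components of Tor as homology of strands -/

section Homology

variable {R : Type u} [CommRing R] {n : ℕ} {A : Type v} [AddCommGroup A]
  [Module (MvPolynomial (Fin n) R) A] {𝓐 : (Fin n → ℤ) → AddSubgroup A}
  {N : Type w} [AddCommGroup N] [Module (MvPolynomial (Fin n) R) N]
  {𝓝 : (Fin n → ℤ) → AddSubgroup N}

theorem coverMap_mem (π : GradedProj (R := R) 𝓝) {a : Fin n → ℤ}
    {f : HomGen R 𝓝 →₀ MvPolynomial (Fin n) R} (hf : f ∈ freeGrading R HomGen.deg a) :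
    coverMap R 𝓝 f ∈ 𝓝 a := by
  have h := coverMap_proj π a f
  have h' : freeProj HomGen.deg a f = f := (GradedProj.free HomGen.deg).proj_same a f hf
  rw [h'] at h
  rw [h]
  exact π.proj_mem a _

theorem resD_mem (π : GradedProj (R := R) 𝓝) (k : ℕ) {a : Fin n → ℤ} {f : Res R 𝓝 (k + 1)}
    (hf : f ∈ resGrading R 𝓝 (k + 1) a) : resD R 𝓝 k f ∈ resGrading R 𝓝 k a :=
  coverMap_mem (π.stageRel k) hf

theorem resD_resD (k : ℕ) (x : Res R 𝓝 (k + 2)) : resD R 𝓝 k (resD R 𝓝 (k + 1) x) = 0 :=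
  congrArg Subtype.val (coverMap R (stage R 𝓝 (k + 1)).relGrading x).2

theorem torD_torD (k : ℕ) (x : A ⊗[MvPolynomial (Fin n) R] Res R 𝓝 (k + 2)) :
    torD R A 𝓝 k (torD R A 𝓝 (k + 1) x) = 0 := by
  have h : resD R 𝓝 k ∘ₗ resD R 𝓝 (k + 1) = 0 := LinearMap.ext (resD_resD k)
  rw [torD, torD, ← LinearMap.comp_apply, ← LinearMap.lTensor_comp, h, LinearMap.lTensor_zero,
    LinearMap.zero_apply]

variable (R 𝓐 𝓝) in
/-- The chains of homological degree `i` and degree `a` in `A ⊗_S P`. -/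
noncomputable abbrev chains (a : Fin n → ℤ) (i : ℕ) :
    AddSubgroup (A ⊗[MvPolynomial (Fin n) R] Res R 𝓝 i) :=
  tensorGrading (MvPolynomial (Fin n) R) 𝓐 (resGrading R 𝓝 i) a

theorem torD_mem (π : GradedProj (R := R) 𝓝) (k : ℕ) (a : Fin n → ℤ)
    (x : A ⊗[MvPolynomial (Fin n) R] Res R 𝓝 (k + 1)) (hx : x ∈ chains R 𝓐 𝓝 a (k + 1)) :
    torD R A 𝓝 k x ∈ chains R 𝓐 𝓝 a k := by
  rw [← add_zero a]
  refine map_mem_of_tensorGrading (torD R A 𝓝 k).toAddMonoidHom 0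
    (fun c d y hy f hf => ?_) a x hx
  rw [add_zero]
  exact tmul_mem_tensorGrading rfl hy (resD_mem π k hf)

/-- The differential of the chains of degree `a`. -/
noncomputable def chainsD (π : GradedProj (R := R) 𝓝) (a : Fin n → ℤ) (k : ℕ) :
    chains R 𝓐 𝓝 a (k + 1) →+ chains R 𝓐 𝓝 a k :=
  ((torD R A 𝓝 k).toAddMonoidHom.comp (AddSubgroup.subtype _)).codRestrict _
    fun x => torD_mem π k a x.1 x.2

theorem coe_mem_torCycles (π : GradedProj (R := R) 𝓝) (a : Fin n → ℤ) (i : ℕ)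
    {x : chains R 𝓐 𝓝 a i} : x ∈ cycles (K := fun i => chains R 𝓐 𝓝 a i) (chainsD π a) i ↔
      x.1 ∈ torCycles R A 𝓝 i := by
  cases i with
  | zero => exact ⟨fun _ => trivial, fun _ => trivial⟩
  | succ i => exact Subtype.ext_iff

/-- The class of a homogeneous cycle. -/
noncomputable def torClass (π : GradedProj (R := R) 𝓝) (a : Fin n → ℤ) (i : ℕ) :
    cycles (K := fun i => chains R 𝓐 𝓝 a i) (chainsD π a) i →+ torDegree R 𝓐 𝓝 i a :=
  AddMonoidHom.mk' (fun x => ⟨Submodule.Quotient.mk ⟨x.1.1, (coe_mem_torCycles π a i).1 x.2⟩,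
    ⟨_, x.1.2, rfl⟩⟩) fun _ _ => rfl

/-- The point is that a homogeneous boundary bounds a homogeneous chain of the same degree: the
projections `ρ` commute with the differential. -/
theorem isHomology_torClass (π : GradedProj (R := R) 𝓝)
    (ρ : ∀ i, Proj (chains R 𝓐 𝓝 · i)) (a : Fin n → ℤ) :
    IsHomology (K := fun i => chains R 𝓐 𝓝 a i) (chainsD π a)
      (H := fun i => torDegree R 𝓐 𝓝 i a) (torClass π a) where
  d_mem i y := by
    rw [coe_mem_torCycles]
    cases i with
    | zero => trivial
    | succ i => exact torD_torD i y.1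
  surjective i := by
    rintro ⟨_, z, hz, rfl⟩
    exact ⟨⟨⟨z.1, hz⟩, (coe_mem_torCycles π a i).2 z.2⟩, rfl⟩
  cls_eq_zero i z := by
    rw [Subtype.ext_iff]
    refine (Submodule.Quotient.mk_eq_zero _).trans ⟨?_, ?_⟩
    · rintro ⟨y, hy⟩
      have hy : torD R A 𝓝 i y = z.1.1 := hy
      obtain ⟨y', hy', h⟩ := (ρ (i + 1)).exists_mem_map_eq (ρ i) (torD R A 𝓝 i).toAddMonoidHom 0
        (fun b x hx => by rw [add_zero]; exact torD_mem π i b x hx) a y (by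
          rw [add_zero]
          exact hy ▸ z.1.2)
      exact ⟨⟨y', hy'⟩, Subtype.ext (h.trans hy)⟩
    · rintro ⟨y, hy⟩
      exact ⟨y.1, congrArg Subtype.val hy⟩

end Homology

/-! ### Syzygies and flatness over `R` -/

section FlatKer

/-- With `j` the inclusion of a syzygy module, `j ∘ c` is a differential of the resolution.
Exactness after tensoring then follows from right exactness once `A ⊗ j` is injective. -/
theorem mem_range_lTensor_of_exact {S : Type*} [CommRing S] {P₂ P₁ P₀ K : Type*} [AddCommGroup P₂]
    [AddCommGroup P₁] [AddCommGroup P₀] [AddCommGroup K] [Module S P₂] [Module S P₁] [Module S P₀]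
    [Module S K] (A : Type*) [AddCommGroup A] [Module S A] {d : P₂ →ₗ[S] P₁} {c : P₁ →ₗ[S] K}
    {j : K →ₗ[S] P₀} (hdc : Function.Exact d c) (hc : Function.Surjective c)
    (hj : Function.Injective (j.lTensor A)) {x : A ⊗[S] P₁} (hx : (j ∘ₗ c).lTensor A x = 0) :
    x ∈ LinearMap.range (d.lTensor A) := by
  rw [LinearMap.lTensor_comp_apply] at hx
  exact (lTensor_exact A hdc hc x).1 (hj (hx.trans (map_zero _).symm))

variable {R : Type u} [CommRing R] {n : ℕ} {P N : Type*} [AddCommGroup P]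
  [Module (MvPolynomial (Fin n) R) P] [Module R P] [IsScalarTower R (MvPolynomial (Fin n) R) P]
  [AddCommGroup N] [Module (MvPolynomial (Fin n) R) N] [Module R N]
  [IsScalarTower R (MvPolynomial (Fin n) R) N]

theorem flat_ker [Module.Flat R P] [Module.Flat R N]
    (f : P →ₗ[MvPolynomial (Fin n) R] N)
    (hf : Function.Surjective f) :
    Module.Flat R (LinearMap.ker f) :=
  flat_of_shortExact (f := (LinearMap.ker f).subtype.restrictScalars R)
    (g := f.restrictScalars R) (Submodule.injective_subtype _)
    (LinearMap.exact_subtype_ker_map f) hf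

/-- If `M` is flat, tensoring preserves the inclusion; if `N` is flat, the sequence has a flat
quotient. -/
theorem rTensor_ker_injective {M : Type*} [AddCommGroup M] [Module R M]
    (h : Module.Flat R M ∨ Module.Flat R N) (f : P →ₗ[MvPolynomial (Fin n) R] N)
    (hf : Function.Surjective f) :
    Function.Injective (((LinearMap.ker f).subtype.restrictScalars R).rTensor M) := by
  rcases h with h | h
  · exact Module.Flat.rTensor_preserves_injective_linearMap _ (Submodule.injective_subtype _)
  · rw [← LinearMap.lTensor_inj_iff_rTensor_inj]
    exact lTensor_injective_of_flat_quotient M (g := f.restrictScalars R)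
      (Submodule.injective_subtype _) (LinearMap.exact_subtype_ker_map f) hf

variable {𝓝 : (Fin n → ℤ) → AddSubgroup N}

theorem flat_cover_rel
    (π : GradedProj (R := R) 𝓝) [Module.Flat R N] : Module.Flat R (cover R 𝓝).rel :=
  flat_ker (coverMap R 𝓝) (coverMap_surjective π)

theorem flat_stage_rel
    (π : GradedProj (R := R) 𝓝) [Module.Flat R N] (k : ℕ) : Module.Flat R (stage R 𝓝 k).rel := by
  induction k with
  | zero => exact flat_cover_rel π
  | succ k ih => exact flat_cover_rel (π.stageRel k)

end FlatKer

/-! ### Vanishing of higher Tor for `F = ∅` -/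

section Vanishing

variable {R : Type u} [CommRing R] {n : ℕ} {M : Type v} [AddCommGroup M] [Module R M]
  [Module (MvPolynomial (Fin n) R) M] [IsScalarTower R (MvPolynomial (Fin n) R) M]

instance compatibleSMul_supported_empty : TensorProduct.CompatibleSMul R
    (MvPolynomial.supported R ((∅ : Finset (Fin n)) : Set (Fin n))) (MvPolynomial (Fin n) R) M where
  smul_tmul := by
    rintro ⟨t, ht⟩ p m
    rw [Finset.coe_empty, MvPolynomial.supported_empty] at ht
    obtain ⟨r, rfl⟩ := Algebra.mem_bot.1 ht
    change (algebraMap R _ r * p) ⊗ₜ m = p ⊗ₜ (algebraMap R (MvPolynomial (Fin n) R) r • m)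
    rw [← Algebra.smul_def, algebraMap_smul, TensorProduct.smul_tmul]

/-- `(S ⊗_{R[∅]} M) ⊗_S Y` is `Y ⊗_R M`. -/
noncomputable def extendEmptyTensorEquiv (R : Type u) [CommRing R] {n : ℕ} (M : Type v)
    [AddCommGroup M] [Module R M] [Module (MvPolynomial (Fin n) R) M]
    [IsScalarTower R (MvPolynomial (Fin n) R) M] (Y : Type w) [AddCommGroup Y]
    [Module R Y] [Module (MvPolynomial (Fin n) R) Y] [IsScalarTower R (MvPolynomial (Fin n) R) Y] :
    (Extend R M (∅ : Finset (Fin n)) ⊗[MvPolynomial (Fin n) R] Y) ≃ₗ[MvPolynomial (Fin n) R]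
      Y ⊗[R] M :=
  (TensorProduct.congr (TensorProduct.equivOfCompatibleSMul R
      (MvPolynomial.supported R ((∅ : Finset (Fin n)) : Set (Fin n))) (MvPolynomial (Fin n) R) _ M)
    (LinearEquiv.refl _ Y)) ≪≫ₗ TensorProduct.comm _ _ _ ≪≫ₗ
    TensorProduct.AlgebraTensorModule.cancelBaseChange R (MvPolynomial (Fin n) R)
      (MvPolynomial (Fin n) R) Y M

theorem extendEmptyTensorEquiv_tmul {Y : Type w} [AddCommGroup Y]
    [Module R Y] [Module (MvPolynomial (Fin n) R) Y] [IsScalarTower R (MvPolynomial (Fin n) R) Y]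
    (p : MvPolynomial (Fin n) R) (m : M) (y : Y) :
    extendEmptyTensorEquiv R M Y ((p ⊗ₜ m) ⊗ₜ y) = (p • y) ⊗ₜ m :=
  rfl

/-- Naturality of `extendEmptyTensorEquiv` turns a question over `S` into one over `R`, where the
flatness hypothesis applies. -/
theorem lTensor_extend_empty_injective {Y : Type*} [AddCommGroup Y]
    [Module R Y] [Module (MvPolynomial (Fin n) R) Y] [IsScalarTower R (MvPolynomial (Fin n) R) Y]
    {Z : Type*} [AddCommGroup Z]
    [Module R Z] [Module (MvPolynomial (Fin n) R) Z] [IsScalarTower R (MvPolynomial (Fin n) R) Z]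
    (f : Y →ₗ[MvPolynomial (Fin n) R] Z)
    (hf : Function.Injective ((f.restrictScalars R).rTensor M)) :
    Function.Injective (f.lTensor (Extend R M (∅ : Finset (Fin n)))) := by
  have comm : ∀ x, extendEmptyTensorEquiv R M Z (f.lTensor (Extend R M (∅ : Finset (Fin n))) x) =
      (f.restrictScalars R).rTensor M (extendEmptyTensorEquiv R M Y x) := by
    intro x
    induction x using TensorProduct.induction_on with
    | zero => simp
    | add x y hx hy => simp only [map_add, hx, hy]
    | tmul x y =>
      induction x using TensorProduct.induction_on with
      | zero => simp
      | add x x' hx hx' => simp only [TensorProduct.add_tmul, map_add, hx, hx']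
      | tmul p m =>
        rw [LinearMap.lTensor_tmul, extendEmptyTensorEquiv_tmul, extendEmptyTensorEquiv_tmul,
          LinearMap.rTensor_tmul, LinearMap.restrictScalars_apply, map_smul]
  intro x y hxy
  apply (extendEmptyTensorEquiv R M Y).injective
  apply hf
  rw [← comm, ← comm, hxy]

variable {N : Type w} [AddCommGroup N] [Module (MvPolynomial (Fin n) R) N]
  {𝓝 : (Fin n → ℤ) → AddSubgroup N}

theorem subsingleton_tor_of_lTensor_injective (A : Type*) [AddCommGroup A]
    [Module (MvPolynomial (Fin n) R) A] (π : GradedProj (R := R) 𝓝) (i : ℕ)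
    (h : Function.Injective ((stage R 𝓝 i).rel.subtype.lTensor A)) :
    Subsingleton (Tor R A 𝓝 (i + 1)) := by
  have ex : Function.Exact (resD R 𝓝 (i + 1)) (coverMap R (stage R 𝓝 i).relGrading) := by
    intro y
    constructor
    · intro hy
      obtain ⟨z, hz⟩ := coverMap_surjective (π.stageRel (i + 1)) ⟨y, hy⟩
      exact ⟨z, congrArg Subtype.val hz⟩
    · rintro ⟨z, rfl⟩
      exact (coverMap R (stage R 𝓝 (i + 1)).relGrading z).2
  refine subsingleton_of_forall_eq 0 fun y => ?_
  obtain ⟨⟨x, hx⟩⟩ := y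
  exact (Submodule.Quotient.mk_eq_zero _).2 (mem_range_lTensor_of_exact _ ex
    (coverMap_surjective (π.stageRel i)) h hx)

theorem lTensor_ker_injective {P Q : Type*} [AddCommGroup P] [Module (MvPolynomial (Fin n) R) P]
    [Module R P] [IsScalarTower R (MvPolynomial (Fin n) R) P] [AddCommGroup Q]
    [Module (MvPolynomial (Fin n) R) Q] [Module R Q] [IsScalarTower R (MvPolynomial (Fin n) R) Q]
    (h : Module.Flat R M ∨ Module.Flat R Q) (f : P →ₗ[MvPolynomial (Fin n) R] Q)
    (hf : Function.Surjective f) :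
    Function.Injective ((LinearMap.ker f).subtype.lTensor (Extend R M (∅ : Finset (Fin n)))) :=
  lTensor_extend_empty_injective _ (rTensor_ker_injective h f hf)

theorem lTensor_cover_rel_injective [Module R N] [IsScalarTower R (MvPolynomial (Fin n) R) N]
    (π : GradedProj (R := R) 𝓝) (h : Module.Flat R M ∨ Module.Flat R N) :
    Function.Injective
      ((cover R 𝓝).rel.subtype.lTensor (Extend R M (∅ : Finset (Fin n)))) :=
  lTensor_ker_injective h (coverMap R 𝓝) (coverMap_surjective π)

/-- Each syzygy module is the kernel of a cover of the previous one (of `N` at the start). Flatness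
of `M` serves all stages, and flatness of `N` is inherited by the syzygies. -/
theorem lTensor_stage_rel_injective [Module R N] [IsScalarTower R (MvPolynomial (Fin n) R) N]
    (π : GradedProj (R := R) 𝓝) (h : Module.Flat R M ∨ Module.Flat R N) (k : ℕ) :
    Function.Injective
      ((stage R 𝓝 k).rel.subtype.lTensor (Extend R M (∅ : Finset (Fin n)))) := by
  cases k with
  | zero => exact lTensor_cover_rel_injective π h
  | succ k =>
    exact lTensor_cover_rel_injective (π.stageRel k)
      (h.imp_right fun _ : Module.Flat R N => flat_stage_rel π k)

theorem subsingleton_tor_extend_empty [Module R N] [IsScalarTower R (MvPolynomial (Fin n) R) N]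
    (π : GradedProj (R := R) 𝓝) (h : Module.Flat R M ∨ Module.Flat R N) (i : ℕ) :
    Subsingleton (Tor R (Extend R M (∅ : Finset (Fin n))) 𝓝 (i + 1)) :=
  subsingleton_tor_of_lTensor_injective _ π i (lTensor_stage_rel_injective π h i)

end Vanishing

/-- The definition of a polyseq asks for maps at every `s`; for `s ∈ F` they are unconstrained and
taken to be zero. -/
theorem exists_fundamental_maps {n : ℕ} {H : Finset (Fin n) → ℕ → (Fin n → ℤ) → Type*}
    [∀ F i a, AddCommGroup (H F i a)]
    (h : ∀ (F : Finset (Fin n)) (s : Fin n), s ∉ F → ∀ a : Fin n → ℤ,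
      ∃ (iota : ∀ i, H F i a →+ H (insert s F) i a)
        (pi : ∀ i, H (insert s F) (i + 1) a →+ H F i (a - eps s))
        (del : ∀ i, H F i (a - eps s) →+ H F i a),
        (∀ i, Function.Exact (del i) (iota i)) ∧ Function.Surjective (iota 0) ∧
        (∀ i, Function.Exact (iota (i + 1)) (pi i)) ∧ (∀ i, Function.Exact (pi i) (del i))) :
    ∃ (iota : ∀ F i a s, H F i a →+ H (insert s F) i a)
      (pi : ∀ F i a s, H (insert s F) (i + 1) a →+ H F i (a - eps s))
      (del : ∀ F i a s, H F i (a - eps s) →+ H F i a),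
      ∀ (F : Finset (Fin n)) (s : Fin n), s ∉ F → ∀ a : Fin n → ℤ,
        (∀ i, Function.Exact (del F i a s) (iota F i a s)) ∧
        Function.Surjective (iota F 0 a s) ∧
        (∀ i, Function.Exact (iota F (i + 1) a s) (pi F i a s)) ∧
        (∀ i, Function.Exact (pi F i a s) (del F i a s)) := by
  have h' : ∀ (F : Finset (Fin n)) (s : Fin n) (a : Fin n → ℤ),
      ∃ (iota : ∀ i, H F i a →+ H (insert s F) i a)
        (pi : ∀ i, H (insert s F) (i + 1) a →+ H F i (a - eps s))
        (del : ∀ i, H F i (a - eps s) →+ H F i a), s ∉ F →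
        (∀ i, Function.Exact (del i) (iota i)) ∧ Function.Surjective (iota 0) ∧
        (∀ i, Function.Exact (iota (i + 1)) (pi i)) ∧ (∀ i, Function.Exact (pi i) (del i)) := by
    intro F s a
    by_cases hs : s ∈ F
    · exact ⟨fun _ => 0, fun _ => 0, fun _ => 0, fun h => absurd hs h⟩
    · obtain ⟨iota, pi, del, h⟩ := h F s hs a
      exact ⟨iota, pi, del, fun _ => h⟩
  choose iota pi del h' using h'
  exact ⟨fun F i a s => iota F s a i, fun F i a s => pi F s a i, fun F i a s => del F s a i,
    fun F s hs a => h' F s a hs⟩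

/-! ### The fundamental exact sequence -/

section Fundamental

variable {R : Type u} [CommRing R] {n : ℕ} {M : Type v} [AddCommGroup M]
  [Module (MvPolynomial (Fin n) R) M] {𝓜 : (Fin n → ℤ) → AddSubgroup M}
  {N : Type w} [AddCommGroup N] [Module (MvPolynomial (Fin n) R) N]
  {𝓝 : (Fin n → ℤ) → AddSubgroup N}

theorem rTensor_torD {A B : Type*} [AddCommGroup A] [AddCommGroup B]
    [Module (MvPolynomial (Fin n) R) A] [Module (MvPolynomial (Fin n) R) B]
    (f : A →ₗ[MvPolynomial (Fin n) R] B) (i : ℕ)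
    (x : A ⊗[MvPolynomial (Fin n) R] Res R 𝓝 (i + 1)) :
    f.rTensor (Res R 𝓝 i) (torD R A 𝓝 i x) = torD R B 𝓝 i (f.rTensor (Res R 𝓝 (i + 1)) x) := by
  rw [torD, torD, ← LinearMap.comp_apply, ← LinearMap.comp_apply, LinearMap.rTensor_comp_lTensor,
    LinearMap.lTensor_comp_rTensor]

theorem rTensor_mem_chains {A B : Type*} [AddCommGroup A] [AddCommGroup B]
    [Module (MvPolynomial (Fin n) R) A] [Module (MvPolynomial (Fin n) R) B]
    {𝓐 : (Fin n → ℤ) → AddSubgroup A} {𝓑 : (Fin n → ℤ) → AddSubgroup B}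
    (f : A →ₗ[MvPolynomial (Fin n) R] B) (d : Fin n → ℤ)
    (hf : ∀ b, ∀ x ∈ 𝓐 b, f x ∈ 𝓑 (b + d)) (i : ℕ) (a : Fin n → ℤ)
    (x : A ⊗[MvPolynomial (Fin n) R] Res R 𝓝 i) (hx : x ∈ chains R 𝓐 𝓝 a i) :
    f.rTensor (Res R 𝓝 i) x ∈ chains R 𝓑 𝓝 (a + d) i :=
  map_mem_of_tensorGrading (f.rTensor (Res R 𝓝 i)).toAddMonoidHom d
    (fun b c x hx y hy => tmul_mem_tensorGrading (by abel) (hf b x hx) hy) a x hx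

/-- The projections of the chains of `(S ⊗_{R[F]} M) ⊗_S P`. -/
noncomputable def Proj.extendChains (π : GradedProj (R := R) 𝓜) (F : Finset (Fin n)) (i : ℕ) :
    Proj (chains R (extendGrading R 𝓜 F) 𝓝 · i) :=
  Proj.tensorFree (Proj.extend π F) (fun _ _ _ hp _ hx => smul_mem_extendGrading hp hx) _

theorem exists_fundamental_sequence (π : GradedProj (R := R) 𝓜) (ρ : GradedProj (R := R) 𝓝)
    (F : Finset (Fin n)) (s : Fin n) (hs : s ∉ F) (a : Fin n → ℤ) :
    ∃ (iota : ∀ i, torDegree R (extendGrading R 𝓜 F) 𝓝 i a →+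
        torDegree R (extendGrading R 𝓜 (insert s F)) 𝓝 i a)
      (pi : ∀ i, torDegree R (extendGrading R 𝓜 (insert s F)) 𝓝 (i + 1) a →+
        torDegree R (extendGrading R 𝓜 F) 𝓝 i (a - eps s))
      (del : ∀ i, torDegree R (extendGrading R 𝓜 F) 𝓝 i (a - eps s) →+
        torDegree R (extendGrading R 𝓜 F) 𝓝 i a),
      (∀ i, Function.Exact (del i) (iota i)) ∧ Function.Surjective (iota 0) ∧
      (∀ i, Function.Exact (iota (i + 1)) (pi i)) ∧ (∀ i, Function.Exact (pi i) (del i)) := by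
  let φ (i : ℕ) := (extendDiff R M F s).rTensor (Res R 𝓝 i)
  let ψ (i : ℕ) := (extendMap R M F s).rTensor (Res R 𝓝 i)
  have hφ (i : ℕ) := rTensor_mem_chains (𝓝 := 𝓝) _ _ (extendDiff_mem F s π) i
  have hψ (i : ℕ) := rTensor_mem_chains (𝓝 := 𝓝) _ 0
    (fun b x hx => (add_zero b).symm ▸ extendMap_mem (R := R) (𝓜 := 𝓜) F s b x hx) i
  -- The modules of the resolution are free, hence flat, over `S`.
  have φ_inj (i : ℕ) : Function.Injective (φ i) :=
    Module.Flat.rTensor_preserves_injective_linearMap _ (extendDiff_injective hs)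
  have ψ_surj (i : ℕ) : Function.Surjective (ψ i) :=
    LinearMap.rTensor_surjective _ (extendMap_surjective R M F s)
  have φψ (i : ℕ) : Function.Exact (φ i) (ψ i) :=
    rTensor_exact _ (exact_extendDiff_extendMap R M F s) (extendMap_surjective R M F s)
  let f (i : ℕ) : chains R (extendGrading R 𝓜 F) 𝓝 (a - eps s) i →+
      chains R (extendGrading R 𝓜 F) 𝓝 a i :=
    ((φ i).toAddMonoidHom.comp (AddSubgroup.subtype _)).codRestrict _
      fun x => by
        have h := hφ i _ x.1 x.2
        rw [sub_add_cancel] at h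
        exact h
  let g (i : ℕ) : chains R (extendGrading R 𝓜 F) 𝓝 a i →+
      chains R (extendGrading R 𝓜 (insert s F)) 𝓝 a i :=
    ((ψ i).toAddMonoidHom.comp (AddSubgroup.subtype _)).codRestrict _
      fun x => by
        have h := hψ i _ x.1 x.2
        rw [add_zero] at h
        exact h
  refine IsHomology.longExact (isHomology_torClass ρ (Proj.extendChains π F) (a - eps s))
    (isHomology_torClass ρ (Proj.extendChains π F) a)
    (isHomology_torClass ρ (Proj.extendChains π (insert s F)) a) f g
    (fun i x => Subtype.ext (rTensor_torD _ i x.1)) (fun i x => Subtype.ext (rTensor_torD _ i x.1))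
    (fun i x y h => Subtype.ext (φ_inj i (congrArg Subtype.val h))) (fun i x => ⟨fun h => ?_, ?_⟩)
    (fun i y => ?_)
  · obtain ⟨y, hy⟩ := (φψ i x.1).1 (congrArg Subtype.val h)
    -- Exactness survives in each degree: the preimage is replaced by its component of degree `a -
    -- ε_s`.
    obtain ⟨y', hy', h'⟩ := (Proj.extendChains π F i).exists_mem_map_eq (Proj.extendChains π F i)
      (φ i).toAddMonoidHom (eps s) (hφ i) (a - eps s) y (by
        rw [sub_add_cancel]
        exact hy ▸ x.2)
    exact ⟨⟨y', hy'⟩, Subtype.ext (h'.trans hy)⟩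
  · rintro ⟨y, rfl⟩
    exact Subtype.ext ((φψ i).apply_apply_eq_zero y.1)
  · obtain ⟨x, hx⟩ := ψ_surj i y.1
    obtain ⟨x', hx', h'⟩ := (Proj.extendChains π F i).exists_mem_map_eq
      (Proj.extendChains π (insert s F) i) (ψ i).toAddMonoidHom 0 (hψ i) a x (by
        rw [add_zero]
        exact hx ▸ y.2)
    exact ⟨⟨x', hx'⟩, Subtype.ext (h'.trans hx)⟩

theorem subsingleton_torDegree {A : Type*} [AddCommGroup A] [Module (MvPolynomial (Fin n) R) A]
    {𝓐 : (Fin n → ℤ) → AddSubgroup A} {i : ℕ} {a : Fin n → ℤ}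
    (h : chains R 𝓐 𝓝 a i = ⊥) : Subsingleton (torDegree R 𝓐 𝓝 i a) := by
  refine subsingleton_of_forall_eq 0 ?_
  rintro ⟨_, z, hz, rfl⟩
  have hz : z.1 ∈ chains R 𝓐 𝓝 a i := hz
  rw [h] at hz
  obtain rfl : z = 0 := Subtype.ext hz
  rfl

end Fundamental

end ZnGraded

theorem proposition3p2 {R : Type u} [CommRing R] (n : ℕ) {M : Type v} {N : Type w}
    [AddCommGroup M] [Module R M] [Module (MvPolynomial (Fin n) R) M]
    [IsScalarTower R (MvPolynomial (Fin n) R) M]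
    [AddCommGroup N] [Module R N] [Module (MvPolynomial (Fin n) R) N]
    [IsScalarTower R (MvPolynomial (Fin n) R) N]
    (𝓜 : (Fin n → ℤ) → AddSubgroup M) [DirectSum.Decomposition 𝓜]
    [SetLike.GradedSMul (ZnGraded.polyGrading R n) 𝓜]
    (𝓝 : (Fin n → ℤ) → AddSubgroup N) [DirectSum.Decomposition 𝓝]
    [SetLike.GradedSMul (ZnGraded.polyGrading R n) 𝓝]
    (hM : ZnGraded.BoundedBelow 𝓜) (hN : ZnGraded.BoundedBelow 𝓝)
    (hflat : Module.Flat R M ∨ Module.Flat R N) :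
    ZnGraded.IsPolyseq (fun F i a =>
      ZnGraded.torDegree R (ZnGraded.extendGrading R 𝓜 F) 𝓝 i a) := by
  open ZnGraded in
  have π := GradedProj.ofDecomposition (R := R) 𝓜
  have ρ := GradedProj.ofDecomposition (R := R) 𝓝
  refine ⟨fun i hi a => ?_, ?_, ?_⟩
  · obtain ⟨i, rfl⟩ := Nat.exists_eq_succ_of_ne_zero hi.ne'
    have := subsingleton_tor_extend_empty (M := M) ρ hflat i
    -- The whole Tor module is zero, hence so is its component of degree `a`.
    exact inferInstanceAs (Subsingleton (torDegree R (extendGrading R 𝓜 ∅) 𝓝 (i + 1) a))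
  · obtain ⟨c, hc⟩ := hM
    obtain ⟨d, hd⟩ := hN
    -- `c` bounds every `S ⊗_{R[F]} M` and `d` bounds every `P_i`, so `c + d` works uniformly in `F`
    -- and `i`.
    refine ⟨c + d, fun F i a ha => subsingleton_torDegree (tensorGrading_eq_bot (c := c) (d := d)
      (fun b x hx hne => ?_) (fun b y hy hne => ?_) a ha)⟩
    · by_contra! hle
      exact hne (AddSubgroup.mem_bot.1 (extendGrading_eq_bot (R := R) hc F b hle ▸ hx))
    · by_contra! hle
      exact hne (AddSubgroup.mem_bot.1 (resGrading_eq_bot (R := R) hd i b hle.le ▸ hy))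
  · exact exists_fundamental_maps fun F s hs a =>
      exists_fundamental_sequence (R := R) (𝓜 := 𝓜) (𝓝 := 𝓝) π ρ F s hs a
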